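/- **Setting.** Let $n\ge 1$ (agents), $H\ge 1$ (horizon), $d\ge 1$ (feature dimension), $T\ge1$ (rounds) and $R_{\max}\ge 0$. A problem consists of the following data. The state set $\mathcal S$ and the action set $\mathcal A$ are finite, every episode starts in a fixed state $x_1$, and there is a feature map $\phi:\mathcal S\times\mathcal A\to\mathbb R^d$ with $\|\phi(x,a)\|_2\le 1$; these are known to the seller. Unknown to the seller are, for each step $h\in\{1,\dots,H\}$, a vector $\mu_h=(\mu_h^1,\dots,\mu_h^d)$ of measures on $\mathcal S$ and vectors $\theta_{ih}\in\mathbb R^d$ ($0\le i\le n$) with $\|\mu_h(\mathcal S)\|_2\le\sqrt d$ and $\|\theta_{ih}\|_2\le\sqrt d$, such that $\mathbb P_h(x'\mid x,a)=\langle\phi(x,a),\mu_h(x')\rangle$ are transition probabilities, and random rewards of the seller ($i=0$), with values in $[0,R_{\max}]$, and of the agents ($1\le i\le n$), with values in $[0,1]$, such that $r_{i,h}(x,a):=\mathbb E[\text{reward of } i \text{ at step } h \text{ in } (x,a)]=\langle\phi(x,a),\theta_{ih}\rangle$. Given the visited states and actions, the realised rewards are independent. Let $\Theta=\Theta(n,H,d,R_{\max})$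 be the class of these problems. A policy is $\pi=(\pi_h)_{h\le H}$ with $\pi_h:\mathcal S\to\mathcal A$, and $V_1^\pi(x_1;\rho)=\mathbb E_\pi\big[\sum_{h=1}^H\rho_h(x_h,\pi_h(x_h))\big]$ for $\rho=(\rho_h)_{h\le H}$, $\rho_h:\mathcal S\times\mathcal A\to\mathbb R$. In each round $t=1,\dots,T$ an algorithm, possibly randomised, knowing $n,H,d,T,R_{\max},\mathcal S,\mathcal A,x_1,\phi$ and everything observed in earlier rounds, chooses a policy $\pi_t$, observes the states $x_1,\dots,x_{H+1}$ of an episode under $\pi_t$ and all rewards realised in it (the agents are truthful: the rewards they report are the realised ones), and then charges real prices $p_{it}$, $1\le i\le n$. Put $R=\sum_{i=0}^n r_i$, $R^{-i}=\sum_{j\ne i}r_j$, $\pi_*\in\arg\max_\pi V_1^\pi(x_1;R)$, $\pi_*^{-i}\in\arg\max_\pi V_1^\pi(x_1;R^{-i})$, and let $$p_{i*}=V_1^{\pi_*^{-i}}(x_1;R^{-i})-V_1^{\pi_*}(x_1;R^{-i}),\quad u_{i*}=V_1^{\pi_*}(x_1;r_i)-p_{i*},\quad u_{0*}=V_1^{\pi_*}(x_1;r_0)+\sum_{i=1}^n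 p_{i*}$$ be the prices and utilities of the Markov VCG mechanism ($u_{i*}$ and $u_{0*}$ do not depend on the choice of the maximisers). The regrets are $$\mathrm{Reg}^W_T=T\,V_1^{\pi_*}(x_1;R)-\sum_{t=1}^T V_1^{\pi_t}(x_1;R),\qquad \mathrm{Reg}^\sharp_T=\sum_{i=1}^n\Big(T u_{i*}-\sum_{t=1}^T\big(V_1^{\pi_t}(x_1;r_i)-p_{it}\big)\Big),$$ $$\mathrm{Reg}_{0T}=T u_{0*}-\sum_{t=1}^T\Big(V_1^{\pi_t}(x_1;r_0)+\sum_{i=1}^n p_{it}\Big).$$ **Theorem.** There is an absolute constant $c>0$ such that for all $n\ge 3$, $H\ge 2$, $d\ge 4$, $R_{\max}\ge0$ and $T\ge\max\{16(n-1)/(H-1),\,64(d-3)^2H\}$, and for every algorithm, there is a problem in $\Theta(n,H,d,R_{\max})$ on which $$\mathbb E\big[\max\big(n\,\mathrm{Reg}^W_T,\ \mathrm{Reg}^\sharp_T,\ \mathrm{Reg}_{0T}\big)\big]\ \ge\ c\,\big(n^{4/3}H^{2/3}T^{2/3}+n^2 d\sqrt{HT}\big).$$ (The maximum is non-negative; its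 expectation may be $+\infty$.) -/

import Mathlib

open MeasureTheory ProbabilityTheory
open scoped ENNReal

noncomputable section

namespace LinVCG

/-- What the seller knows in advance about the environment, for feature dimension `d`:
a finite state set, a finite non-empty action set, the initial state of every episode, and
the feature map `φ`, whose values have Euclidean norm at most `1`. -/
structure Setting (d : ℕ) where
  nS : ℕ
  nA : ℕ
  nA_pos : 0 < nA
  x₁ : Fin nS
  φ : Fin nS → Fin nA → EuclideanSpace ℝ (Fin d)
  norm_φ_le : ∀ x a, ‖φ x a‖ ≤ 1

/-- States. -/
abbrev Setting.S {d : ℕ} (E : Setting d) : Type := Fin E.nS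

/-- Actions. -/
abbrev Setting.A {d : ℕ} (E : Setting d) : Type := Fin E.nA

instance {d : ℕ} (E : Setting d) : Nonempty E.A := ⟨⟨0, E.nA_pos⟩⟩

/-- A policy of the seller: for each of the `H` steps, a map from states to actions. -/
abbrev Policy {d : ℕ} (E : Setting d) (H : ℕ) : Type := Fin H → E.S → E.A

/-- The data of one episode: the visited states `x_1, …, x_{H+1}` and the realised rewards of the
seller (index `0`) and of the agents (indices `1, …, n`) at each of the `H` steps. -/
abbrev Episode {d : ℕ} (E : Setting d) (n H : ℕ) : Type :=
  (Fin (H + 1) → E.S) × (Fin (n + 1) → Fin H → ℝ)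

/-- One round: the policy that was played, the data of the episode (the actions are those that the
policy prescribes in the visited states), and the prices charged to the `n` agents. -/
abbrev Round {d : ℕ} (E : Setting d) (n H : ℕ) : Type :=
  Policy E H × Episode E n H × (Fin n → ℝ)

/-- A linear MDP with `n` agents and horizon `H` on a given setting: the unknown part of a problem.
* `μ h x'` is the vector of masses that the `d` measures of step `h` give to `x'`; the
  probability of moving from `x` to `x'` under action `a` at step `h` is `⟪φ x a, μ h x'⟫`.
* `rewardLaw i h x a` is the law of the (random) reward of participant `i` at step `h` in state `x`
  under action `a`. It is carried by `[0, Rmax]` for the seller (`i = 0`), by `[0, 1]` for the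
  agents, and its mean is `⟪φ x a, θ i h⟫`. -/
structure LinearMDP {d : ℕ} (E : Setting d) (n H : ℕ) (Rmax : ℝ) where
  μ : Fin H → E.S → EuclideanSpace ℝ (Fin d)
  θ : Fin (n + 1) → Fin H → EuclideanSpace ℝ (Fin d)
  rewardLaw : Fin (n + 1) → Fin H → E.S → E.A → Measure ℝ
  μ_nonneg : ∀ h x j, 0 ≤ μ h x j
  trans_nonneg : ∀ h x a x', 0 ≤ inner ℝ (E.φ x a) (μ h x')
  trans_sum : ∀ h x a, ∑ x', inner ℝ (E.φ x a) (μ h x') = 1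
  rewardLaw_prob : ∀ i h x a, IsProbabilityMeasure (rewardLaw i h x a)
  rewardLaw_seller : ∀ h x a, ∀ᵐ y ∂(rewardLaw 0 h x a), y ∈ Set.Icc 0 Rmax
  rewardLaw_agent : ∀ (i : Fin n) h x a, ∀ᵐ y ∂(rewardLaw i.succ h x a), y ∈ Set.Icc (0 : ℝ) 1
  reward_mean : ∀ i h x a, ∫ y, y ∂(rewardLaw i h x a) = inner ℝ (E.φ x a) (θ i h)
  norm_μ_le : ∀ h, ‖∑ x, μ h x‖ ≤ √(d : ℝ)
  norm_θ_le : ∀ i h, ‖θ i h‖ ≤ √(d : ℝ)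

namespace LinearMDP

variable {d : ℕ} {E : Setting d} {n H : ℕ} {Rmax : ℝ}

instance (M : LinearMDP E n H Rmax) (i : Fin (n + 1)) (h : Fin H) (x : E.S) (a : E.A) :
    IsProbabilityMeasure (M.rewardLaw i h x a) := M.rewardLaw_prob i h x a

/-- The transition probability from `x` to `x'` under action `a` at step `h`. -/
def P (M : LinearMDP E n H Rmax) (h : Fin H) (x : E.S) (a : E.A) (x' : E.S) : ℝ :=
  inner ℝ (E.φ x a) (M.μ h x')

/-- The mean reward of participant `i` at step `h`. -/
def r (M : LinearMDP E n H Rmax) (i : Fin (n + 1)) (h : Fin H) (x : E.S) (a : E.A) : ℝ :=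
  ∫ y, y ∂(M.rewardLaw i h x a)

/-- The sum of all mean rewards. -/
def R (M : LinearMDP E n H Rmax) (h : Fin H) (x : E.S) (a : E.A) : ℝ :=
  ∑ i, M.r i h x a

/-- The sum of all mean rewards except the one of agent `i`. -/
def Rwithout (M : LinearMDP E n H Rmax) (i : Fin n) (h : Fin H) (x : E.S) (a : E.A) : ℝ :=
  ∑ j ∈ Finset.univ.erase i.succ, M.r j h x a

/-- The probability that an episode under `π` visits the states `s 0, …, s H`. -/
def pathProb (M : LinearMDP E n H Rmax) (π : Policy E H) (s : Fin (H + 1) → E.S) : ℝ :=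
  (if s 0 = E.x₁ then 1 else 0) *
    ∏ h : Fin H, M.P h (s h.castSucc) (π h (s h.castSucc)) (s h.succ)

/-- The value `V_1^π(x₁; ρ)`: the expected total reward in an episode under `π`, for the reward
function `ρ`. -/
def value (M : LinearMDP E n H Rmax) (π : Policy E H) (ρ : Fin H → E.S → E.A → ℝ) : ℝ :=
  ∑ s : Fin (H + 1) → E.S, M.pathProb π s * ∑ h : Fin H, ρ h (s h.castSucc) (π h (s h.castSucc))

/-- A policy that maximises `V_1^π(x₁; ρ)`. -/
def optPolicy (M : LinearMDP E n H Rmax) (ρ : Fin H → E.S → E.A → ℝ) : Policy E H :=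
  (Finite.exists_max fun π : Policy E H => M.value π ρ).choose

/-- The price charged to agent `i` by the Markov VCG mechanism. -/
def vcgPrice (M : LinearMDP E n H Rmax) (i : Fin n) : ℝ :=
  M.value (M.optPolicy (M.Rwithout i)) (M.Rwithout i) - M.value (M.optPolicy M.R) (M.Rwithout i)

/-- The utility of agent `i` in the Markov VCG mechanism. -/
def vcgAgentUtility (M : LinearMDP E n H Rmax) (i : Fin n) : ℝ :=
  M.value (M.optPolicy M.R) (M.r i.succ) - M.vcgPrice i

/-- The utility of the seller in the Markov VCG mechanism. -/
def vcgSellerUtility (M : LinearMDP E n H Rmax) : ℝ :=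
  M.value (M.optPolicy M.R) (M.r 0) + ∑ i, M.vcgPrice i

/-- The welfare regret over `T` rounds. -/
def regWelfare (M : LinearMDP E n H Rmax) {T : ℕ} (w : Fin T → Round E n H) : ℝ :=
  T * M.value (M.optPolicy M.R) M.R - ∑ t, M.value (w t).1 M.R

/-- The regret of agent `i` over `T` rounds. -/
def regAgent (M : LinearMDP E n H Rmax) {T : ℕ} (w : Fin T → Round E n H) (i : Fin n) : ℝ :=
  T * M.vcgAgentUtility i - ∑ t, (M.value (w t).1 (M.r i.succ) - (w t).2.2 i)

/-- The sum of the regrets of all agents over `T` rounds. -/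
def regAgents (M : LinearMDP E n H Rmax) {T : ℕ} (w : Fin T → Round E n H) : ℝ :=
  ∑ i, M.regAgent w i

/-- The regret of the seller over `T` rounds. -/
def regSeller (M : LinearMDP E n H Rmax) {T : ℕ} (w : Fin T → Round E n H) : ℝ :=
  T * M.vcgSellerUtility - ∑ t, (M.value (w t).1 (M.r 0) + ∑ i, (w t).2.2 i)

/-- The law of the data of an episode under `π`: a random path of states and, given the path,
independent rewards. -/
def episodeLaw (M : LinearMDP E n H Rmax) (π : Policy E H) : Measure (Episode E n H) :=
  ∑ s : Fin (H + 1) → E.S, ENNReal.ofReal (M.pathProb π s) •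
    (Measure.dirac s).prod (Measure.pi fun i => Measure.pi fun h =>
      M.rewardLaw i h (s h.castSucc) (π h (s h.castSucc)))

/-- `episodeLaw` as a kernel. -/
def episodeKernel (M : LinearMDP E n H Rmax) : Kernel (Policy E H) (Episode E n H) :=
  Kernel.ofFunOfCountable M.episodeLaw

end LinearMDP

/-- A (possibly randomised) strategy of the seller on a given setting. In round `t` the seller first
chooses a policy, given everything observed in the earlier rounds; then the episode takes
place, the seller observes the states and all rewards (the agents being truthful, the reported
rewards are the realised ones), and then charges prices, given everything observed so far. -/
structure Strategy {d : ℕ} (E : Setting d) (n H : ℕ) where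
  policy : (t : ℕ) → Kernel (Fin t → Round E n H) (Policy E H)
  price : (t : ℕ) → Kernel (((Fin t → Round E n H) × Policy E H) × Episode E n H) (Fin n → ℝ)
  policy_markov : ∀ t, IsMarkovKernel (policy t)
  price_markov : ∀ t, IsMarkovKernel (price t)

/-- An algorithm: a strategy for every setting. -/
abbrev Algorithm (n H d : ℕ) : Type := (E : Setting d) → Strategy E n H

namespace Strategy

variable {d : ℕ} {E : Setting d} {n H : ℕ} {Rmax : ℝ}

/-- The conditional law of a round given the earlier rounds, when `σ` is run on `M`. -/
def roundKernel (σ : Strategy E n H) (M : LinearMDP E n H Rmax) (t : ℕ) :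
    Kernel (Fin t → Round E n H) (Round E n H) :=
  (σ.policy t).compProd ((M.episodeKernel.comap Prod.snd measurable_snd).compProd (σ.price t))

/-- The law of the first `t` rounds when `σ` is run on `M`. -/
def law (σ : Strategy E n H) (M : LinearMDP E n H Rmax) : (t : ℕ) → Measure (Fin t → Round E n H)
  | 0 => Measure.dirac Fin.elim0
  | t + 1 => ((law σ M t).compProd (σ.roundKernel M t)).map
      fun p => Fin.snoc (α := fun _ => Round E n H) p.1 p.2

/-- The expectation over `T` rounds of `max (n Reg^W_T, Reg^♯_T, Reg_{0T})`, when `σ` is run on `M`.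
The maximum is non-negative, since the welfare regret is; the expectation may be infinite. -/
def expectedMaxRegret (σ : Strategy E n H) (M : LinearMDP E n H Rmax) (T : ℕ) : ℝ≥0∞ :=
  ∫⁻ w, ENNReal.ofReal (max (n * M.regWelfare w) (max (M.regAgents w) (M.regSeller w)))
    ∂(σ.law M T)

end Strategy

end LinVCG

end

noncomputable section

namespace LinVCG

/-! ### Likelihood ratios and the two-point method for adaptive strategies. -/

namespace Strategy

variable {d : ℕ} {E : Setting d} {n H : ℕ} {Rmax : ℝ}

/-! Each summand of the bound has its own family of hard problems; the final problem comes from the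
family whose bound is larger. In both, only the first action matters: it leads at random to one of
three absorbing states, where deterministic rewards are paid in the remaining `H - 1` steps. A bad
first action thus costs `H - 1` times, while an episode reveals a single draw.

Prices (`TwoArm`). Two disjoint groups `A`, `B` have `k` agents each, with `k` of order `n`. The
safe action gives `A` a mean of `k / 2` per step, the other gives `B` a mean of `k / 2 - δ`. The
safe action is optimal, yet each agent of `A` owes `(H - 1) * (1 / 2 - δ)`, and only the inferior
action reveals `δ`. Prices cancel in `regAgents + regSeller = regWelfare`, and the latter is
non-negative; so if two values of `δ` cannot be told apart, the same charges are too low for the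
seller under one or too high for the agents under the other. Telling them apart takes many inferior
actions, for which `n * regWelfare` pays. With `b ^ 3 = n ^ 2 * H * T` and success probabilities `1
/ (2 * b)` apart, either way costs at least order `b ^ 2`.

Transitions (`Cube`). Actions are the vertices of a cube of dimension `d - 3`, and every coordinate
that differs from a hidden vertex costs welfare. By Assouad's argument, each coordinate is wrong in
a constant fraction of the rounds, on average over hidden vertices, when the effect of a coordinate
is of order `1 / √T`.

Both rest on `Strategy.two_point`, which bounds the Bhattacharyya coefficient of two adaptive
histories by the Hellinger distances of the episodes actually played, averaged under both laws. -/

instance (σ : Strategy E n H) (t : ℕ) : IsMarkovKernel (σ.policy t) := σ.policy_markov t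

instance (σ : Strategy E n H) (t : ℕ) : IsMarkovKernel (σ.price t) := σ.price_markov t

instance (σ : Strategy E n H) (M : LinearMDP E n H Rmax) [IsMarkovKernel M.episodeKernel] (t : ℕ) :
    IsMarkovKernel (σ.roundKernel M t) := by
  unfold roundKernel
  infer_instance

lemma measurable_snoc {α : Type*} [MeasurableSpace α] (t : ℕ) :
    Measurable fun p : (Fin t → α) × α => Fin.snoc (α := fun _ => α) p.1 p.2 := by
  refine measurable_pi_lambda _ fun i => ?_
  refine Fin.lastCases ?_ (fun j => ?_) i
  · simpa using measurable_snd
  · simp only [Fin.snoc_castSucc]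
    exact (measurable_pi_apply j).comp measurable_fst

instance (σ : Strategy E n H) (M : LinearMDP E n H Rmax) [IsMarkovKernel M.episodeKernel] (t : ℕ) :
    IsProbabilityMeasure (σ.law M t) := by
  induction t with
  | zero => unfold law; infer_instance
  | succ t ih =>
    unfold law
    exact Measure.isProbabilityMeasure_map (measurable_snoc t).aemeasurable

lemma lintegral_law_succ (σ : Strategy E n H) (M : LinearMDP E n H Rmax)
    [IsMarkovKernel M.episodeKernel] (t : ℕ) {F : (Fin (t + 1) → Round E n H) → ℝ≥0∞}
    (hF : Measurable F) :
    ∫⁻ w, F w ∂(σ.law M (t + 1)) =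
      ∫⁻ w, ∫⁻ r, F (Fin.snoc (α := fun _ => Round E n H) w r) ∂(σ.roundKernel M t w)
        ∂(σ.law M t) := by
  rw [law, lintegral_map hF (measurable_snoc t)]
  exact Measure.lintegral_compProd (hF.comp (measurable_snoc t))

lemma lintegral_roundKernel (σ : Strategy E n H) (M : LinearMDP E n H Rmax)
    [IsMarkovKernel M.episodeKernel] (t : ℕ) (w : Fin t → Round E n H)
    {F : Round E n H → ℝ≥0∞} (hF : Measurable F) :
    ∫⁻ r, F r ∂(σ.roundKernel M t w) =
      ∫⁻ p, ∫⁻ e, ∫⁻ c, F (p, e, c) ∂(σ.price t ((w, p), e)) ∂(M.episodeLaw p)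
        ∂(σ.policy t w) := by
  rw [roundKernel, Kernel.lintegral_compProd _ _ _ hF]
  refine lintegral_congr fun p => ?_
  exact Kernel.lintegral_compProd _ _ _ (hF.comp measurable_prodMk_left)

/-- The likelihood ratio of `t` rounds, when `ℓ` is the one of an episode. -/
def likelihood (ℓ : Policy E H × Episode E n H → ℝ≥0∞) {t : ℕ} (w : Fin t → Round E n H) : ℝ≥0∞ :=
  ∏ s, ℓ ((w s).1, (w s).2.1)

lemma likelihood_snoc (ℓ : Policy E H × Episode E n H → ℝ≥0∞) {t : ℕ} (w : Fin t → Round E n H)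
    (r : Round E n H) :
    likelihood ℓ (Fin.snoc (α := fun _ => Round E n H) w r) =
      likelihood ℓ w * ℓ (r.1, r.2.1) := by
  simp [likelihood, Fin.prod_univ_castSucc]

lemma measurable_likelihood {ℓ : Policy E H × Episode E n H → ℝ≥0∞} (hℓ : Measurable ℓ) (t : ℕ) :
    Measurable fun w : Fin t → Round E n H => likelihood ℓ w := by
  unfold likelihood
  refine Finset.measurable_prod _ fun i _ => hℓ.comp ?_
  fun_prop

/-- `ℓ` is the likelihood ratio of the episode laws of `M'` and `M`. -/
def IsRatio (M M' : LinearMDP E n H Rmax) (ℓ : Policy E H × Episode E n H → ℝ≥0∞) : Prop :=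
  Measurable ℓ ∧ ∀ p, ∀ G : Episode E n H → ℝ≥0∞, Measurable G →
    ∫⁻ e, G e ∂(M'.episodeLaw p) = ∫⁻ e, ℓ (p, e) * G e ∂(M.episodeLaw p)

variable {M M' : LinearMDP E n H Rmax} [IsMarkovKernel M.episodeKernel]
  [IsMarkovKernel M'.episodeKernel] {ℓ : Policy E H × Episode E n H → ℝ≥0∞}

lemma lintegral_roundKernel_ratio (σ : Strategy E n H) (hℓ : IsRatio M M' ℓ) (t : ℕ)
    (w : Fin t → Round E n H) {F : Round E n H → ℝ≥0∞} (hF : Measurable F) :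
    ∫⁻ r, F r ∂(σ.roundKernel M' t w) =
      ∫⁻ r, ℓ (r.1, r.2.1) * F r ∂(σ.roundKernel M t w) := by
  have hm : Measurable fun r : Round E n H => ℓ (r.1, r.2.1) * F r :=
    (hℓ.1.comp (by fun_prop)).mul hF
  rw [lintegral_roundKernel _ _ _ _ hF, lintegral_roundKernel _ _ _ _ hm]
  refine lintegral_congr fun p => ?_
  rw [hℓ.2 p]
  · refine lintegral_congr fun e => ?_
    exact (lintegral_const_mul _ (by fun_prop)).symm
  · have : Measurable fun q : Episode E n H × (Fin n → ℝ) => F (p, q.1, q.2) := by fun_prop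
    exact Measurable.lintegral_kernel_prod_right'
      (κ := (σ.price t).comap (fun e => ((w, p), e)) measurable_prodMk_left) this

/-- The kernels that choose policies and prices are the same in both problems, so they cancel from
the density of the histories and only the episode factors survive. -/
lemma lintegral_law_ratio (σ : Strategy E n H) (hℓ : IsRatio M M' ℓ) (t : ℕ)
    {F : (Fin t → Round E n H) → ℝ≥0∞} (hF : Measurable F) :
    ∫⁻ w, F w ∂(σ.law M' t) = ∫⁻ w, likelihood ℓ w * F w ∂(σ.law M t) := by
  induction t with
  | zero => simp [law, likelihood]
  | succ t ih =>
    have hm : Measurable fun r : Round E n H => ℓ (r.1, r.2.1) := hℓ.1.comp (by fun_prop)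
    have hs := hF.comp (measurable_snoc (α := Round E n H) t)
    have hm' : Measurable fun w : Fin (t + 1) → Round E n H => likelihood ℓ w * F w :=
      (measurable_likelihood hℓ.1 _).mul hF
    rw [lintegral_law_succ _ _ _ hF, lintegral_law_succ _ _ _ hm', ih]
    · refine lintegral_congr fun w => ?_
      have hw : Measurable fun r => F (Fin.snoc (α := fun _ => Round E n H) w r) :=
        hs.comp measurable_prodMk_left
      have hp : Measurable fun r : Round E n H =>
          ℓ (r.1, r.2.1) * F (Fin.snoc (α := fun _ => Round E n H) w r) := hm.mul hw
      rw [lintegral_roundKernel_ratio σ hℓ t w hw, ← lintegral_const_mul _ hp]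
      simp_rw [likelihood_snoc, mul_assoc]
    · exact Measurable.lintegral_kernel_prod_right' hs

lemma lintegral_sum_law_succ (σ : Strategy E n H) (M : LinearMDP E n H Rmax)
    [IsMarkovKernel M.episodeKernel] (g : Policy E H → ℝ≥0∞) (t : ℕ) :
    ∫⁻ w, ∑ s, g (w s).1 ∂(σ.law M (t + 1)) =
      ∫⁻ w, ∑ s, g (w s).1 ∂(σ.law M t) + ∫⁻ w, ∫⁻ p, g p ∂(σ.policy t w) ∂(σ.law M t) := by
  have hg : Measurable g := measurable_of_countable g
  have h1 (t : ℕ) : Measurable fun w : Fin t → Round E n H => ∑ s, g (w s).1 := by fun_prop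
  have h2 : Measurable fun r : Round E n H => g r.1 := hg.comp measurable_fst
  rw [lintegral_law_succ _ _ _ (h1 _), ← lintegral_add_left (h1 _)]
  refine lintegral_congr fun w => ?_
  simp_rw [Fin.sum_univ_castSucc, Fin.snoc_castSucc, Fin.snoc_last]
  rw [lintegral_add_left measurable_const, lintegral_roundKernel _ _ _ _ h2]
  have (p : Policy E H) : IsProbabilityMeasure (M.episodeLaw p) :=
    IsMarkovKernel.isProbabilityMeasure (κ := M.episodeKernel) p
  simp

lemma _root_.ENNReal.rpow_half_le (x : ℝ≥0∞) : x ^ (1 / 2 : ℝ) ≤ (1 + x) / 2 := by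
  have h := ENNReal.young_inequality 1 (x ^ (1 / 2 : ℝ)) Real.HolderConjugate.two_two
  rw [← ENNReal.rpow_mul] at h
  simpa [ENNReal.add_div] using h

/-- The Bhattacharyya coefficient of the laws of `t` rounds loses, in every round, at most the
average of the expectations of the squared Hellinger distance `g` of the episode laws. -/
lemma one_le_bhattacharyya_add (σ : Strategy E n H) (hℓ : IsRatio M M' ℓ)
    (g : Policy E H → ℝ≥0∞)
    (hg : ∀ p, 1 ≤ ∫⁻ e, ℓ (p, e) ^ (1 / 2 : ℝ) ∂(M.episodeLaw p) + g p) (t : ℕ) :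
    1 ≤ ∫⁻ w, likelihood ℓ w ^ (1 / 2 : ℝ) ∂(σ.law M t) +
      (∫⁻ w, ∑ s, g (w s).1 ∂(σ.law M t) + ∫⁻ w, ∑ s, g (w s).1 ∂(σ.law M' t)) / 2 := by
  have hgm : Measurable g := measurable_of_countable g
  have hL := fun t => measurable_likelihood (t := t) hℓ.1
  have hLs (t : ℕ) : Measurable fun w : Fin t → Round E n H => likelihood ℓ w ^ (1 / 2 : ℝ) :=
    (hL t).pow_const _
  induction t with
  | zero => simp [law, likelihood]
  | succ t ih =>
    refine ih.trans ?_
    have hγ : Measurable fun w => ∫⁻ p, g p ∂(σ.policy t w) := hgm.lintegral_kernel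
    have hr : Measurable fun r : Round E n H => ℓ (r.1, r.2.1) ^ (1 / 2 : ℝ) :=
      (hℓ.1.comp (by fun_prop)).pow_const _
    have hround (w : Fin t → Round E n H) :
        1 ≤ ∫⁻ r, ℓ (r.1, r.2.1) ^ (1 / 2 : ℝ) ∂(σ.roundKernel M t w) +
          ∫⁻ p, g p ∂(σ.policy t w) := by
      rw [lintegral_roundKernel _ _ _ _ hr, ← lintegral_add_right _ hgm]
      calc (1 : ℝ≥0∞) = ∫⁻ _, 1 ∂(σ.policy t w) := by simp
        _ ≤ _ := lintegral_mono fun p => by simpa using hg p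
    have hγL : Measurable fun w => ∫⁻ p, g p ∂(σ.policy t w) +
        likelihood ℓ w * ∫⁻ p, g p ∂(σ.policy t w) := hγ.add ((hL t).mul hγ)
    -- Loss in one round: the square root of the likelihood times the conditional Hellinger
    -- distance. Since `√L ≤ (1 + L) / 2`, and weighting by `L` changes the law to that of `M'`,
    -- this is at most the average of the two expectations.
    have hBC : ∫⁻ w, likelihood ℓ w ^ (1 / 2 : ℝ) ∂(σ.law M t) ≤
        ∫⁻ w, likelihood ℓ w ^ (1 / 2 : ℝ) ∂(σ.law M (t + 1)) +
          (∫⁻ w, ∫⁻ p, g p ∂(σ.policy t w) ∂(σ.law M t) +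
            ∫⁻ w, ∫⁻ p, g p ∂(σ.policy t w) ∂(σ.law M' t)) / 2 := by
      rw [lintegral_law_ratio σ hℓ t hγ, ← lintegral_add_left hγ, lintegral_law_succ _ _ _ (hLs _),
        ENNReal.div_eq_inv_mul, ← lintegral_const_mul _ hγL,
        ← lintegral_add_right _ (hγL.const_mul _)]
      refine lintegral_mono fun w => ?_
      simp_rw [likelihood_snoc, ENNReal.mul_rpow_of_nonneg _ _ (show (0 : ℝ) ≤ 1 / 2 by norm_num)]
      rw [lintegral_const_mul _ hr]
      calc likelihood ℓ w ^ (1 / 2 : ℝ)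
          ≤ likelihood ℓ w ^ (1 / 2 : ℝ) *
              (∫⁻ r, ℓ (r.1, r.2.1) ^ (1 / 2 : ℝ) ∂(σ.roundKernel M t w) +
                ∫⁻ p, g p ∂(σ.policy t w)) := le_mul_of_one_le_right' (hround w)
        _ ≤ _ := by
          rw [mul_add]
          refine add_le_add le_rfl ?_
          calc _ ≤ (1 + likelihood ℓ w) / 2 * ∫⁻ p, g p ∂(σ.policy t w) :=
                mul_le_mul_left (ENNReal.rpow_half_le _) _
            _ = _ := by
              rw [ENNReal.div_eq_inv_mul, mul_assoc, add_mul, one_mul]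
    rw [lintegral_sum_law_succ, lintegral_sum_law_succ]
    calc _ ≤ _ := add_le_add_left hBC _
      _ = _ := by
        simp_rw [ENNReal.div_eq_inv_mul]
        ring

/-- Cauchy–Schwarz for `√L = √(min 1 L) * √(max 1 L)`; the second factor is controlled by `max 1 L ≤
1 + L`. -/
lemma bhattacharyya_sq_le {Ω : Type*} [MeasurableSpace Ω] (P : Measure Ω) [IsProbabilityMeasure P]
    {L : Ω → ℝ≥0∞} (hL : Measurable L) (hL1 : ∫⁻ w, L w ∂P = 1) :
    (∫⁻ w, L w ^ (1 / 2 : ℝ) ∂P) ^ 2 ≤ 2 * ∫⁻ w, min 1 (L w) ∂P := by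
  have h := ENNReal.lintegral_mul_le_Lp_mul_Lq P Real.HolderConjugate.two_two
    (f := fun w => min 1 (L w) ^ (1 / 2 : ℝ)) (g := fun w => max 1 (L w) ^ (1 / 2 : ℝ))
    ((measurable_const.min hL).pow_const _).aemeasurable
    ((measurable_const.max hL).pow_const _).aemeasurable
  have e (x : ℝ≥0∞) : (x ^ (1 / 2 : ℝ)) ^ (2 : ℝ) = x := by
    rw [← ENNReal.rpow_mul]; norm_num
  simp only [Pi.mul_apply, e, ← ENNReal.mul_rpow_of_nonneg _ _ (show (0 : ℝ) ≤ 1 / 2 by norm_num),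
    min_mul_max, one_mul] at h
  have hmax : ∫⁻ w, max 1 (L w) ∂P ≤ 2 := by
    calc _ ≤ ∫⁻ w, 1 + L w ∂P := lintegral_mono fun w => max_le le_self_add le_add_self
      _ = 2 := by rw [lintegral_add_left measurable_const, hL1]; norm_num
  calc _ ≤ (((∫⁻ w, min 1 (L w) ∂P) * ∫⁻ w, max 1 (L w) ∂P) ^ (1 / 2 : ℝ)) ^ 2 := by
        gcongr
    _ = (∫⁻ w, min 1 (L w) ∂P) * ∫⁻ w, max 1 (L w) ∂P := by
        rw [← ENNReal.rpow_natCast]; exact e _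
    _ ≤ _ := by rw [mul_comm]; gcongr

/-- Two-point method: if the squared Hellinger distances of the episodes add up to at most `1`, the
two problems cannot be told apart. -/
lemma two_point (σ : Strategy E n H) (hℓ : IsRatio M M' ℓ)
    (g : Policy E H → ℝ≥0∞)
    (hg : ∀ p, 1 ≤ ∫⁻ e, ℓ (p, e) ^ (1 / 2 : ℝ) ∂(M.episodeLaw p) + g p) (t : ℕ)
    (hle : ∫⁻ w, ∑ s, g (w s).1 ∂(σ.law M t) + ∫⁻ w, ∑ s, g (w s).1 ∂(σ.law M' t) ≤ 1)
    {F F' : (Fin t → Round E n H) → ℝ≥0∞} (hF : Measurable F) (hF' : Measurable F') {K : ℝ≥0∞}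
    (hK : ∀ w, K ≤ F w + F' w) :
    K / 8 ≤ ∫⁻ w, F w ∂(σ.law M t) + ∫⁻ w, F' w ∂(σ.law M' t) := by
  have hL := measurable_likelihood (t := t) hℓ.1
  have hL1 : ∫⁻ w, likelihood ℓ w ∂(σ.law M t) = 1 := by
    have := lintegral_law_ratio σ hℓ t (F := fun _ => 1) measurable_const
    simpa using this.symm
  -- The coefficient starts at `1` and loses at most half of the total distance allowed by `hle`.
  -- Squaring and halving gives the constant `1 / 8` below.
  have hBC : 2⁻¹ ≤ ∫⁻ w, likelihood ℓ w ^ (1 / 2 : ℝ) ∂(σ.law M t) := by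
    have h1 := (one_le_bhattacharyya_add σ hℓ g hg t).trans
      (add_le_add_right (ENNReal.div_le_div_right hle 2) _)
    nth_rw 1 [← ENNReal.inv_two_add_inv_two] at h1
    rw [ENNReal.div_eq_inv_mul, mul_one] at h1
    exact (ENNReal.add_le_add_iff_right (by simp)).1 h1
  have h2 : 8⁻¹ ≤ ∫⁻ w, min 1 (likelihood ℓ w) ∂(σ.law M t) := by
    have h3 := (pow_le_pow_left' hBC 2).trans (bhattacharyya_sq_le _ hL hL1)
    have h4 : (8 : ℝ≥0∞)⁻¹ = 2⁻¹ * 2⁻¹ ^ 2 := by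
      rw [← ENNReal.inv_pow, ← ENNReal.mul_inv (by simp) (by simp)]; norm_num
    rw [h4]
    calc _ ≤ 2⁻¹ * (2 * ∫⁻ w, min 1 (likelihood ℓ w) ∂(σ.law M t)) := by gcongr
      _ = _ := by rw [← mul_assoc, ENNReal.inv_mul_cancel (by simp) (by simp), one_mul]
  rw [lintegral_law_ratio σ hℓ t hF', ← lintegral_add_left hF]
  calc K / 8 ≤ K * ∫⁻ w, min 1 (likelihood ℓ w) ∂(σ.law M t) := by
        rw [div_eq_mul_inv]; gcongr
    _ = ∫⁻ w, K * min 1 (likelihood ℓ w) ∂(σ.law M t) :=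
        (lintegral_const_mul _ (measurable_const.min hL)).symm
    _ ≤ _ := lintegral_mono fun w => by
        calc K * min 1 (likelihood ℓ w) ≤ (F w + F' w) * min 1 (likelihood ℓ w) := by
              gcongr; exact hK w
          _ = F w * min 1 (likelihood ℓ w) + F' w * min 1 (likelihood ℓ w) := add_mul _ _ _
          _ ≤ F w * 1 + F' w * likelihood ℓ w := by
              gcongr
              · exact min_le_left _ _
              · exact min_le_right _ _
          _ = _ := by rw [mul_one, mul_comm (F' w)]

end Strategy

/-! ### Episode laws: path probabilities, likelihood ratios and Hellinger distances. -/

namespace LinearMDP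

variable {d : ℕ} {E : Setting d} {n H : ℕ} {Rmax : ℝ}

lemma pathProb_nonneg (M : LinearMDP E n H Rmax) (π : Policy E H) (s : Fin (H + 1) → E.S) :
    0 ≤ M.pathProb π s := by
  unfold pathProb
  refine mul_nonneg (by split_ifs <;> norm_num) (Finset.prod_nonneg fun h _ => M.trans_nonneg _ _ _ _)

lemma lintegral_episodeLaw (M : LinearMDP E n H Rmax) (π : Policy E H) {G : Episode E n H → ℝ≥0∞}
    (hG : Measurable G) :
    ∫⁻ e, G e ∂(M.episodeLaw π) = ∑ s, ENNReal.ofReal (M.pathProb π s) *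
      ∫⁻ y, G (s, y) ∂(Measure.pi fun i => Measure.pi fun h =>
        M.rewardLaw i h (s h.castSucc) (π h (s h.castSucc))) := by
  rw [episodeLaw, lintegral_finsetSum_measure]
  refine Finset.sum_congr rfl fun s _ => ?_
  rw [lintegral_smul_measure, smul_eq_mul, lintegral_prod _ hG.aemeasurable, lintegral_dirac]

lemma isMarkovKernel_episodeKernel (M : LinearMDP E n H Rmax)
    (hM : ∀ π, ∑ s, M.pathProb π s = 1) : IsMarkovKernel M.episodeKernel := by
  refine ⟨fun π => ⟨?_⟩⟩
  change M.episodeLaw π Set.univ = 1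
  rw [← lintegral_one, lintegral_episodeLaw _ _ measurable_const]
  simp only [lintegral_one, measure_univ, mul_one]
  rw [← ENNReal.ofReal_sum_of_nonneg fun s _ => M.pathProb_nonneg π s, hM, ENNReal.ofReal_one]

/-- The likelihood ratio of the episode laws of two problems that differ in the transitions. -/
def pathRatio (M M' : LinearMDP E n H Rmax) (q : Policy E H × Episode E n H) : ℝ≥0∞ :=
  ENNReal.ofReal (M'.pathProb q.1 q.2.1) / ENNReal.ofReal (M.pathProb q.1 q.2.1)

lemma measurable_pathRatio (M M' : LinearMDP E n H Rmax) : Measurable (M.pathRatio M') := by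
  have h : Measurable fun q : Policy E H × (Fin (H + 1) → E.S) =>
      ENNReal.ofReal (M'.pathProb q.1 q.2) / ENNReal.ofReal (M.pathProb q.1 q.2) :=
    measurable_of_countable _
  exact h.comp (g := fun q : Policy E H × _ => _)
    (measurable_fst.prodMk (measurable_fst.comp measurable_snd))

/-- With equal reward laws, the conditional law of the rewards given the path is common and drops
out. `h0` is absolute continuity; it makes the convention `0 / 0 = 0` harmless. -/
lemma isRatio_pathRatio {M M' : LinearMDP E n H Rmax} (hr : M'.rewardLaw = M.rewardLaw)
    (h0 : ∀ π s, M.pathProb π s = 0 → M'.pathProb π s = 0) :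
    Strategy.IsRatio M M' (M.pathRatio M') := by
  have hm := M.measurable_pathRatio M'
  refine ⟨hm, fun π G hG => ?_⟩
  rw [lintegral_episodeLaw _ _ hG,
    lintegral_episodeLaw M π (G := fun e => M.pathRatio M' (π, e) * G e)
      ((hm.comp measurable_prodMk_left).mul hG)]
  refine Finset.sum_congr rfl fun s _ => ?_
  rw [hr]
  simp only [pathRatio]
  have hGs : Measurable fun y => G (s, y) := hG.comp measurable_prodMk_left
  rw [lintegral_const_mul _ hGs, ← mul_assoc]
  congr 1
  by_cases hs : M.pathProb π s = 0
  · simp [hs, h0 π s hs]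
  · rw [ENNReal.mul_div_cancel]
    · simpa using lt_of_le_of_ne (M.pathProb_nonneg π s) (Ne.symm hs)
    · simp

lemma lintegral_pathRatio_rpow_half (M M' : LinearMDP E n H Rmax) (π : Policy E H) :
    ∫⁻ e, M.pathRatio M' (π, e) ^ (1 / 2 : ℝ) ∂(M.episodeLaw π) =
      ENNReal.ofReal (∑ s, √(M.pathProb π s * M'.pathProb π s)) := by
  rw [lintegral_episodeLaw M π (G := fun e => M.pathRatio M' (π, e) ^ (1 / 2 : ℝ))
      (((M.measurable_pathRatio M').comp measurable_prodMk_left).pow_const _),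
    ENNReal.ofReal_sum_of_nonneg fun s _ => Real.sqrt_nonneg _]
  refine Finset.sum_congr rfl fun s _ => ?_
  simp only [pathRatio, lintegral_const, measure_univ, mul_one]
  have hp := M.pathProb_nonneg π s
  have hp' := M'.pathProb_nonneg π s
  rcases hp.eq_or_lt with h | h
  · simp [← h]
  · rw [← ENNReal.ofReal_div_of_pos h, ENNReal.ofReal_rpow_of_nonneg (by positivity) (by norm_num),
      ← ENNReal.ofReal_mul hp, ← Real.sqrt_eq_rpow, Real.sqrt_div' _ hp, Real.sqrt_mul hp]
    congr 1
    nth_rw 1 [← Real.mul_self_sqrt hp]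
    field_simp

end LinearMDP

/-- The gap between the two means is `(√p - √q) ^ 2 / 2`, and `|√p - √q| ≤ |p - q|` as soon as `√p +
√q ≥ 1`. -/
lemma half_sq_sub_le_sqrt_mul {p q : ℝ} (h : p = q ∧ 0 ≤ p ∨ 1 / 4 ≤ p ∧ 1 / 4 ≤ q) :
    (p + q) / 2 - (p - q) ^ 2 / 2 ≤ √(p * q) := by
  rcases h with ⟨rfl, h⟩ | ⟨hp, hq⟩
  · rw [Real.sqrt_mul_self h]; linarith
  · have hp' : 1 / 2 ≤ √p := Real.le_sqrt_of_sq_le (by linarith)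
    have hq' : 1 / 2 ≤ √q := Real.le_sqrt_of_sq_le (by linarith)
    have e1 : √p ^ 2 = p := Real.sq_sqrt (by linarith)
    have e2 : √q ^ 2 = q := Real.sq_sqrt (by linarith)
    rw [Real.sqrt_mul (by linarith)]
    have h1 : (√p - √q) ^ 2 * 1 ≤ (√p - √q) ^ 2 * (√p + √q) ^ 2 :=
      mul_le_mul_of_nonneg_left (by nlinarith) (sq_nonneg _)
    have h2 : (√p - √q) ^ 2 * (√p + √q) ^ 2 = (p - q) ^ 2 := by
      rw [← mul_pow, mul_comm, ← sq_sub_sq, e1, e2]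
    nlinarith

/-! ### One-shot problems as linear MDPs: features, paths and values. -/

lemma norm_toLp_le_one {ι : Type*} [Fintype ι] {p : ι → ℝ} (hp : p ∈ stdSimplex ℝ ι) :
    ‖(WithLp.toLp 2 p : EuclideanSpace ℝ ι)‖ ≤ 1 := by
  rw [EuclideanSpace.norm_eq, Real.sqrt_le_one, ← hp.2]
  refine Finset.sum_le_sum fun j _ => ?_
  have h1 := hp.1 j
  have h2 : p j ≤ 1 := hp.2 ▸ Finset.single_le_sum (fun i _ => hp.1 i) (Finset.mem_univ j)
  simp only [Real.norm_eq_abs, sq_abs]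
  nlinarith

lemma norm_toLp_le_sqrt {d : ℕ} {p : Fin d → ℝ} (hp : ∀ j, p j ∈ Set.Icc (0 : ℝ) 1) :
    ‖(WithLp.toLp 2 p : EuclideanSpace ℝ (Fin d))‖ ≤ √(d : ℝ) := by
  rw [EuclideanSpace.norm_eq]
  refine Real.sqrt_le_sqrt ?_
  calc _ ≤ ∑ _j : Fin d, (1 : ℝ) := Finset.sum_le_sum fun j _ => by
        have := hp j
        simp only [Real.norm_eq_abs, sq_abs]
        nlinarith [this.1, this.2]
    _ = d := by simp

lemma sum_mul_mem_Icc {ι : Type*} [Fintype ι] {p t : ι → ℝ} (hp : p ∈ stdSimplex ℝ ι)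
    (ht : ∀ j, t j ∈ Set.Icc (0 : ℝ) 1) : ∑ j, p j * t j ∈ Set.Icc (0 : ℝ) 1 := by
  refine ⟨Finset.sum_nonneg fun j _ => mul_nonneg (hp.1 j) (ht j).1, ?_⟩
  rw [← hp.2]
  exact Finset.sum_le_sum fun j _ => mul_le_of_le_one_right (hp.1 j) (ht j).2

/-- The features: the actions in the start state `0` mix them, and the other states have one each. -/
def feature {m nA : ℕ} (v : Fin nA → Fin (3 + m) → ℝ) (x : Fin 4) (a : Fin nA) :
    Fin (3 + m) → ℝ :=
  Fin.cases (motive := fun _ => Fin (3 + m) → ℝ) (v a) (fun i => Pi.single (Fin.castAdd m i) 1) x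

lemma feature_mem {m nA : ℕ} {v : Fin nA → Fin (3 + m) → ℝ}
    (hv : ∀ a, v a ∈ stdSimplex ℝ (Fin (3 + m))) (x : Fin 4) (a : Fin nA) :
    feature v x a ∈ stdSimplex ℝ (Fin (3 + m)) := by
  refine Fin.cases ?_ (fun i => ?_) x
  · exact hv a
  · exact single_mem_stdSimplex ℝ _

lemma inner_toLp {d : ℕ} (f t : Fin d → ℝ) :
    inner ℝ (WithLp.toLp 2 f : EuclideanSpace ℝ (Fin d)) (WithLp.toLp 2 t) = ∑ j, f j * t j := by
  simp [PiLp.inner_apply, mul_comm]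

/-- The setting of a one-shot problem. From the start state `0`, the first action `a` leads to one
of the states `1`, `2`, `3`, where the episode stays. -/
abbrev armSetting (m : ℕ) {nA : ℕ} (hA : 0 < nA) (v : Fin nA → Fin (3 + m) → ℝ)
    (hv : ∀ a, v a ∈ stdSimplex ℝ (Fin (3 + m))) : Setting (3 + m) where
  nS := 4
  nA := nA
  nA_pos := hA
  x₁ := 0
  φ x a := WithLp.toLp 2 (feature v x a)
  norm_φ_le x a := norm_toLp_le_one (feature_mem hv x a)

/-- The parameters of a one-shot problem: feature `j` leads to the state `y.succ` with probability
`ν j y`, where agent `i` gets the reward `u i y` in every step. -/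
structure ArmData (m n : ℕ) where
  ν : Fin (3 + m) → Fin 3 → ℝ
  u : Fin n → Fin 3 → ℝ
  ν_mem : ∀ j, ν j ∈ stdSimplex ℝ (Fin 3)
  u_mem : ∀ i y, u i y ∈ Set.Icc (0 : ℝ) 1

namespace ArmData

variable {m n : ℕ} (D : ArmData m n)

/-- Where the features lead in step `h`. -/
def dest {K : ℕ} (h : Fin (K + 1)) (j : Fin (3 + m)) : Fin 3 → ℝ :=
  Fin.cases (motive := fun _ => Fin 3 → ℝ) (D.ν j)
    (fun _ => Fin.addCases (motive := fun _ => Fin 3 → ℝ) (fun i => Pi.single i 1)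
      -- A default: after the first step the start state has been left for good, and no other state
      -- uses these features.
      (fun _ => Pi.single 2 1) j) h

lemma dest_mem {K : ℕ} (h : Fin (K + 1)) (j : Fin (3 + m)) :
    D.dest h j ∈ stdSimplex ℝ (Fin 3) := by
  refine Fin.cases ?_ (fun i => ?_) h
  · exact D.ν_mem j
  · refine Fin.addCases (fun i => ?_) (fun i => ?_) j
    · simpa [dest] using single_mem_stdSimplex ℝ i
    · simpa [dest] using single_mem_stdSimplex ℝ (2 : Fin 3)

/-- The mass that feature `j` gives to the state `x` in step `h`. -/
def mass {K : ℕ} (h : Fin (K + 1)) (x : Fin 4) (j : Fin (3 + m)) : ℝ :=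
  Fin.cases (motive := fun _ => ℝ) 0 (D.dest h j) x

lemma mass_nonneg {K : ℕ} (h : Fin (K + 1)) (x : Fin 4) (j : Fin (3 + m)) : 0 ≤ D.mass h x j := by
  refine Fin.cases le_rfl (fun i => ?_) x
  exact (D.dest_mem h j).1 i

lemma sum_mass {K : ℕ} (h : Fin (K + 1)) (j : Fin (3 + m)) : ∑ x, D.mass h x j = 1 := by
  rw [Fin.sum_univ_succ]
  simpa [mass] using (D.dest_mem h j).2

/-- The reward of participant `i` for feature `j` in step `h`. -/
def rew {K : ℕ} (i : Fin (n + 1)) (h : Fin (K + 1)) (j : Fin (3 + m)) : ℝ :=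
  Fin.cases (motive := fun _ => ℝ) 0 (fun i => Fin.cases (motive := fun _ => ℝ) 0
    (fun _ => Fin.addCases (motive := fun _ => ℝ) (D.u i) (fun _ => 0) j) h) i

lemma rew_mem {K : ℕ} (i : Fin (n + 1)) (h : Fin (K + 1)) (j : Fin (3 + m)) :
    D.rew i h j ∈ Set.Icc (0 : ℝ) 1 := by
  refine Fin.cases ?_ (fun i => ?_) i
  · simp [rew]
  · refine Fin.cases ?_ (fun h => ?_) h
    · simp [rew]
    · refine Fin.addCases (fun j => ?_) (fun j => ?_) j
      · simpa [rew] using D.u_mem i j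
      · simp [rew]

variable {nA : ℕ} {hA : 0 < nA} {v : Fin nA → Fin (3 + m) → ℝ}
  {hv : ∀ a, v a ∈ stdSimplex ℝ (Fin (3 + m))}

/-- The one-shot problem with given parameters. -/
def mdp (hA : 0 < nA) (hv : ∀ a, v a ∈ stdSimplex ℝ (Fin (3 + m))) (K : ℕ) {Rmax : ℝ}
    (hR : 0 ≤ Rmax) : LinearMDP (armSetting m hA v hv) n (K + 1) Rmax where
  μ h x := WithLp.toLp 2 (D.mass h x)
  θ i h := WithLp.toLp 2 (D.rew i h)
  -- Rewards equal their means, so problems with the same `u` differ only through the first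
  -- transition.
  rewardLaw i h x a := Measure.dirac (∑ j, feature v x a j * D.rew i h j)
  μ_nonneg h x j := D.mass_nonneg h x j
  trans_nonneg h x a x' := by
    rw [inner_toLp]
    exact Finset.sum_nonneg fun j _ => mul_nonneg ((feature_mem hv x a).1 j) (D.mass_nonneg h x' j)
  trans_sum h x a := by
    simp_rw [inner_toLp]
    rw [Finset.sum_comm]
    simp_rw [← Finset.mul_sum]
    exact (Finset.sum_congr rfl fun j _ => by rw [D.sum_mass, mul_one]).trans
      (feature_mem hv x a).2
  rewardLaw_prob i h x a := inferInstance
  rewardLaw_seller h x a := by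
    refine (ae_dirac_iff measurableSet_Icc).2 ?_
    simpa [rew] using hR
  rewardLaw_agent i h x a :=
    (ae_dirac_iff measurableSet_Icc).2 (sum_mul_mem_Icc (feature_mem hv x a) (D.rew_mem _ _))
  reward_mean i h x a := (integral_dirac _ _).trans (inner_toLp _ _).symm
  norm_μ_le h := by
    have : ∑ x, (WithLp.toLp 2 (D.mass h x) : EuclideanSpace ℝ (Fin (3 + m))) =
        WithLp.toLp 2 fun _ => 1 := by
      ext j
      simpa using D.sum_mass h j
    exact (congrArg norm this).trans_le (norm_toLp_le_sqrt fun _ => by simp)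
  norm_θ_le i h := norm_toLp_le_sqrt (D.rew_mem i h)

variable {K : ℕ} {Rmax : ℝ} {hR : 0 ≤ Rmax}

/-- The probability that the first action `a` leads to the state `y.succ`. -/
def Q (v : Fin nA → Fin (3 + m) → ℝ) (a : Fin nA) (y : Fin 3) : ℝ := ∑ j, v a j * D.ν j y

lemma Q_nonneg (hv : ∀ a, v a ∈ stdSimplex ℝ (Fin (3 + m))) (a : Fin nA) (y : Fin 3) :
    0 ≤ D.Q v a y :=
  Finset.sum_nonneg fun j _ => mul_nonneg ((hv a).1 j) ((D.ν_mem j).1 y)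

lemma sum_Q (hv : ∀ a, v a ∈ stdSimplex ℝ (Fin (3 + m))) (a : Fin nA) : ∑ y, D.Q v a y = 1 := by
  unfold Q
  rw [Finset.sum_comm]
  simp_rw [← Finset.mul_sum]
  exact (Finset.sum_congr rfl fun j _ => by rw [(D.ν_mem j).2, mul_one]).trans (hv a).2

lemma P_start (a : Fin nA) (y : Fin 4) :
    (D.mdp hA hv K hR).P 0 (0 : Fin 4) a y = Fin.cases (motive := fun _ => ℝ) 0 (D.Q v a) y := by
  refine (inner_toLp _ _).trans ?_
  refine Fin.cases ?_ (fun y => ?_) y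
  · simp [mass]
  · rfl

lemma P_stay (h : Fin K) (x : Fin 3) (a : Fin nA) (y : Fin 4) :
    (D.mdp hA hv K hR).P h.succ x.succ a y = if y = x.succ then 1 else 0 := by
  refine (inner_toLp _ _).trans ?_
  refine Fin.cases ?_ (fun y => ?_) y
  · rw [if_neg (Fin.succ_ne_zero x).symm]
    simp [mass]
  · simp [mass, dest, feature, Pi.single_apply]

lemma r_zero (h : Fin (K + 1)) (x : Fin 4) (a : Fin nA) :
    (D.mdp hA hv K hR).r 0 h x a = 0 := by
  refine (integral_dirac _ _).trans ?_
  simp [rew]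

lemma r_start (i : Fin n) (x : Fin 4) (a : Fin nA) :
    (D.mdp hA hv K hR).r i.succ 0 x a = 0 := by
  refine (integral_dirac _ _).trans ?_
  simp [rew]

lemma r_stay (i : Fin n) (h : Fin K) (y : Fin 3) (a : Fin nA) :
    (D.mdp hA hv K hR).r i.succ h.succ y.succ a = D.u i y := by
  refine (integral_dirac _ _).trans ?_
  simp [rew, feature, Pi.single_apply]

/-- The path of an episode that moves to the state `y.succ`. -/
def path (K : ℕ) (y : Fin 3) : Fin (K + 2) → Fin 4 := Fin.cons 0 fun _ => y.succ

lemma path_injective (K : ℕ) : Function.Injective (path K) := fun y z h => by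
  simpa [path] using congrFun h 1

lemma pathProb_path (π : Policy (armSetting m hA v hv) (K + 1)) (y : Fin 3) :
    (D.mdp hA hv K hR).pathProb π (path K y) = D.Q v (π 0 (0 : Fin 4)) y := by
  unfold LinearMDP.pathProb
  rw [if_pos (show path K y 0 = (0 : Fin 4) from rfl), one_mul, Fin.prod_univ_succ]
  have h0 := D.P_start (hA := hA) (hv := hv) (K := K) (hR := hR) (π 0 (0 : Fin 4)) y.succ
  have h1 : ∀ h : Fin K, (D.mdp hA hv K hR).P h.succ (path K y h.succ.castSucc)
      (π h.succ (path K y h.succ.castSucc)) (path K y h.succ.succ) = 1 := fun h => by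
    have := D.P_stay (hA := hA) (hv := hv) (hR := hR) h y (π h.succ y.succ) y.succ
    rw [if_pos rfl] at this
    exact this
  rw [Finset.prod_congr rfl fun h _ => h1 h, Finset.prod_const_one, mul_one]
  exact h0

lemma pathProb_eq_zero (π : Policy (armSetting m hA v hv) (K + 1)) {s : Fin (K + 2) → Fin 4}
    (hs : s ∉ Set.range (path K)) : (D.mdp hA hv K hR).pathProb π s = 0 := by
  by_contra hne
  unfold LinearMDP.pathProb at hne
  have h0 : s 0 = 0 := by
    by_contra h
    exact hne (by rw [if_neg h, zero_mul])
  have hP := Finset.prod_ne_zero_iff.1 (right_ne_zero_of_mul hne)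
  refine hs ?_
  have h1 : s 1 ≠ 0 := fun h1 => by
    refine hP 0 (Finset.mem_univ _) ?_
    have := D.P_start (hA := hA) (hv := hv) (K := K) (hR := hR) (π 0 0) 0
    change (D.mdp hA hv K hR).P 0 (s 0) (π 0 (s 0)) (s 1) = 0
    rw [h0, h1]
    exact this
  obtain ⟨y, hy⟩ := Fin.exists_succ_eq.2 h1
  refine ⟨y, ?_⟩
  have hall : ∀ i : Fin (K + 1), s i.succ = y.succ := fun i => by
    induction i using Fin.induction with
    | zero => exact hy.symm
    | succ i ih =>
      by_contra h
      refine hP i.succ (Finset.mem_univ _) ?_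
      have := D.P_stay (hA := hA) (hv := hv) (hR := hR) i y (π i.succ y.succ) (s i.succ.succ)
      rw [if_neg h] at this
      have e : s i.succ.castSucc = y.succ := ih
      rw [e]
      exact this
  funext i
  exact Fin.cases h0.symm (fun i => (hall i).symm) i

lemma sum_paths (G : (Fin (K + 2) → Fin 4) → ℝ) (hG : ∀ s ∉ Set.range (path K), G s = 0) :
    ∑ s, G s = ∑ y, G (path K y) :=
  (Fintype.sum_of_injective (path K) (path_injective K) _ _ hG fun _ => rfl).symm

lemma sum_pathProb (π : Policy (armSetting m hA v hv) (K + 1)) :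
    ∑ s, (D.mdp hA hv K hR).pathProb π s = 1 := by
  refine (sum_paths _ fun s hs => D.pathProb_eq_zero π hs).trans ?_
  simp_rw [pathProb_path]
  exact D.sum_Q hv _

instance : IsMarkovKernel (D.mdp hA hv K hR).episodeKernel :=
  LinearMDP.isMarkovKernel_episodeKernel _ D.sum_pathProb

/-- The probability-weighted mean of `f` after the first action `a`. -/
def avg (v : Fin nA → Fin (3 + m) → ℝ) (f : Fin 3 → ℝ) (a : Fin nA) : ℝ := ∑ y, D.Q v a y * f y

/-- The first of the `K + 1` steps pays nothing; the state reached then pays in each of the other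
`K`. -/
lemma value_eq (π : Policy (armSetting m hA v hv) (K + 1))
    {ρ : Fin (K + 1) → Fin 4 → Fin nA → ℝ} {f : Fin 3 → ℝ} (h0 : ∀ a, ρ 0 0 a = 0)
    (h1 : ∀ (h : Fin K) y a, ρ h.succ y.succ a = f y) :
    (D.mdp hA hv K hR).value π ρ = K * D.avg v f (π 0 (0 : Fin 4)) := by
  refine (sum_paths _ fun s hs => by rw [D.pathProb_eq_zero π hs, zero_mul]).trans ?_
  rw [avg, Finset.mul_sum]
  refine Finset.sum_congr rfl fun y _ => ?_
  rw [pathProb_path, Fin.sum_univ_succ]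
  have e0 := h0 (π 0 (0 : Fin 4))
  have e1 : ∀ h : Fin K, ρ h.succ (path K y h.succ.castSucc)
      (π h.succ (path K y h.succ.castSucc)) = f y := fun h => h1 h y _
  rw [Finset.sum_congr rfl fun h _ => e1 h]
  have e2 : ρ 0 (path K y (Fin.castSucc 0)) (π 0 (path K y (Fin.castSucc 0))) = 0 := e0
  rw [e2]
  simp
  ring

end ArmData

/-! ### Linearity of values and the identity linking the three regrets. -/

namespace LinearMDP

variable {d : ℕ} {E : Setting d} {n H : ℕ} {Rmax : ℝ}

lemma value_le_optPolicy (M : LinearMDP E n H Rmax) (π : Policy E H)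
    (ρ : Fin H → E.S → E.A → ℝ) : M.value π ρ ≤ M.value (M.optPolicy ρ) ρ :=
  (Finite.exists_max fun π : Policy E H => M.value π ρ).choose_spec π

lemma value_sum (M : LinearMDP E n H Rmax) (π : Policy E H) {ι : Type*} (s : Finset ι)
    (ρ : ι → Fin H → E.S → E.A → ℝ) :
    M.value π (fun h x a => ∑ i ∈ s, ρ i h x a) = ∑ i ∈ s, M.value π (ρ i) := by
  unfold value
  rw [Finset.sum_comm]
  refine Finset.sum_congr rfl fun p _ => ?_
  rw [Finset.sum_comm, Finset.mul_sum]

lemma value_R (M : LinearMDP E n H Rmax) (π : Policy E H) :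
    M.value π M.R = M.value π (M.r 0) + ∑ i : Fin n, M.value π (M.r i.succ) := by
  rw [← Fin.sum_univ_succ fun i => M.value π (M.r i)]
  exact M.value_sum π Finset.univ M.r

lemma value_Rwithout (M : LinearMDP E n H Rmax) (π : Policy E H) (i : Fin n) :
    M.value π (M.Rwithout i) = M.value π M.R - M.value π (M.r i.succ) := by
  have h1 : M.value π (M.Rwithout i) = _ := M.value_sum π (Finset.univ.erase i.succ) M.r
  have h2 : M.value π M.R = _ := M.value_sum π Finset.univ M.r
  rw [h1, h2, ← Finset.sum_erase_add _ _ (Finset.mem_univ i.succ), add_sub_cancel_right]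

lemma regWelfare_eq_sum (M : LinearMDP E n H Rmax) {T : ℕ} (w : Fin T → Round E n H) :
    M.regWelfare w = ∑ t, (M.value (M.optPolicy M.R) M.R - M.value (w t).1 M.R) := by
  simp [regWelfare, Finset.sum_sub_distrib]

lemma regWelfare_nonneg (M : LinearMDP E n H Rmax) {T : ℕ} (w : Fin T → Round E n H) :
    0 ≤ M.regWelfare w := by
  rw [regWelfare_eq_sum]
  exact Finset.sum_nonneg fun t _ => sub_nonneg.2 (M.value_le_optPolicy _ _)

/-- Payments, both the charged ones and those of the mechanism, are transfers from the agents to the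
seller. -/
lemma regAgents_add_regSeller (M : LinearMDP E n H Rmax) {T : ℕ} (w : Fin T → Round E n H) :
    M.regAgents w + M.regSeller w = M.regWelfare w := by
  unfold regAgents regAgent regSeller regWelfare vcgAgentUtility vcgSellerUtility
  simp_rw [value_R, Finset.sum_sub_distrib, ← Finset.mul_sum, Finset.sum_sub_distrib,
    Finset.sum_add_distrib]
  rw [Finset.sum_comm (γ := Fin n) (s := Finset.univ) (t := (Finset.univ : Finset (Fin T)))
      (f := fun i t => M.value (w t).1 (M.r i.succ)),
    Finset.sum_comm (γ := Fin n) (s := Finset.univ) (t := (Finset.univ : Finset (Fin T)))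
      (f := fun i t => (w t).2.2 i)]
  ring

end LinearMDP

/-! ### Values and the two-point method for one-shot problems. -/

namespace ArmData

variable {m n : ℕ} (D : ArmData m n) {nA : ℕ} {hA : 0 < nA} {v : Fin nA → Fin (3 + m) → ℝ}
  {hv : ∀ a, v a ∈ stdSimplex ℝ (Fin (3 + m))} {K : ℕ} {Rmax : ℝ} {hR : 0 ≤ Rmax}

lemma value_seller (π : Policy (armSetting m hA v hv) (K + 1)) :
    (D.mdp hA hv K hR).value π ((D.mdp hA hv K hR).r 0) = 0 := by
  rw [D.value_eq π (f := fun _ => 0) (fun _ => D.r_zero _ _ _) fun _ _ _ => D.r_zero _ _ _]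
  simp [avg]

lemma value_agent (π : Policy (armSetting m hA v hv) (K + 1)) (i : Fin n) :
    (D.mdp hA hv K hR).value π ((D.mdp hA hv K hR).r i.succ) =
      K * D.avg v (D.u i) (π 0 (0 : Fin 4)) :=
  D.value_eq π (fun _ => D.r_start _ _ _) fun _ _ _ => D.r_stay _ _ _ _

lemma value_welfare (π : Policy (armSetting m hA v hv) (K + 1)) :
    (D.mdp hA hv K hR).value π (D.mdp hA hv K hR).R =
      K * ∑ i, D.avg v (D.u i) (π 0 (0 : Fin 4)) := by
  rw [LinearMDP.value_R, value_seller, zero_add, Finset.mul_sum]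
  exact Finset.sum_congr rfl fun i _ => D.value_agent π i

/-- The squared Hellinger distance of the episodes of two problems is bounded by this. -/
def dist (D D' : ArmData m n) (v : Fin nA → Fin (3 + m) → ℝ) (a : Fin nA) : ℝ :=
  (∑ y, (D.Q v a y - D'.Q v a y) ^ 2) / 2

lemma one_le_bhattacharyya_add_dist {D D' : ArmData m n}
    (hQ : ∀ a y, D.Q v a y = D'.Q v a y ∨ 1 / 4 ≤ D.Q v a y ∧ 1 / 4 ≤ D'.Q v a y)
    (π : Policy (armSetting m hA v hv) (K + 1)) :
    1 ≤ ∫⁻ e, (D.mdp hA hv K hR).pathRatio (D'.mdp hA hv K hR) (π, e) ^ (1 / 2 : ℝ)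
        ∂((D.mdp hA hv K hR).episodeLaw π) +
      ENNReal.ofReal (dist D D' v (π 0 (0 : Fin 4))) := by
  rw [LinearMDP.lintegral_pathRatio_rpow_half]
  have h : ∑ s, √((D.mdp hA hv K hR).pathProb π s * (D'.mdp hA hv K hR).pathProb π s) =
      ∑ y, √(D.Q v (π 0 (0 : Fin 4)) y * D'.Q v (π 0 (0 : Fin 4)) y) := by
    refine (sum_paths _ fun s hs => by
      rw [D.pathProb_eq_zero π hs, zero_mul, Real.sqrt_zero]).trans ?_
    simp_rw [pathProb_path]
  rw [h, ← ENNReal.ofReal_add (by positivity) (by unfold dist; positivity), ← ENNReal.ofReal_one]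
  refine ENNReal.ofReal_le_ofReal ?_
  set a := π 0 (0 : Fin 4)
  have h1 : ∑ y, ((D.Q v a y + D'.Q v a y) / 2 - (D.Q v a y - D'.Q v a y) ^ 2 / 2) ≤
      ∑ y, √(D.Q v a y * D'.Q v a y) :=
    Finset.sum_le_sum fun y _ => half_sq_sub_le_sqrt_mul
      ((hQ a y).imp_left fun h => ⟨h, D.Q_nonneg hv a y⟩)
  rw [Finset.sum_sub_distrib, ← Finset.sum_div, Finset.sum_add_distrib, D.sum_Q hv, D'.sum_Q hv,
    ← Finset.sum_div] at h1
  unfold dist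
  linarith

lemma two_point {D D' : ArmData m n} (hu : D'.u = D.u)
    (hQ : ∀ a y, D.Q v a y = D'.Q v a y ∨ 1 / 4 ≤ D.Q v a y ∧ 1 / 4 ≤ D'.Q v a y)
    (σ : Strategy (armSetting m hA v hv) n (K + 1)) (T : ℕ)
    (hle : ∫⁻ w, ∑ s, ENNReal.ofReal (dist D D' v ((w s).1 0 (0 : Fin 4)))
        ∂(σ.law (D.mdp hA hv K hR) T) +
      ∫⁻ w, ∑ s, ENNReal.ofReal (dist D D' v ((w s).1 0 (0 : Fin 4)))
        ∂(σ.law (D'.mdp hA hv K hR) T) ≤ 1)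
    {F F' : (Fin T → Round (armSetting m hA v hv) n (K + 1)) → ℝ≥0∞} (hF : Measurable F)
    (hF' : Measurable F') {C : ℝ≥0∞} (hC : ∀ w, C ≤ F w + F' w) :
    C / 8 ≤ ∫⁻ w, F w ∂(σ.law (D.mdp hA hv K hR) T) +
      ∫⁻ w, F' w ∂(σ.law (D'.mdp hA hv K hR) T) := by
  refine Strategy.two_point σ (LinearMDP.isRatio_pathRatio ?_ fun π s hs => ?_)
    (fun π => ENNReal.ofReal (dist D D' v (π 0 (0 : Fin 4))))
    (fun π => one_le_bhattacharyya_add_dist hQ π) T hle hF hF' hC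
  · simp only [mdp, rew, hu]
  · by_cases hr : s ∈ Set.range (path K)
    · obtain ⟨y, rfl⟩ := hr
      rw [pathProb_path] at hs ⊢
      rcases hQ (π 0 (0 : Fin 4)) y with h | h
      · rw [← h, hs]
      · linarith [h.1]
    · exact D'.pathProb_eq_zero π hr

end ArmData

namespace Strategy

variable {d : ℕ} {E : Setting d} {n H : ℕ} {Rmax : ℝ}

/-- The maximum of the three regrets. -/
def maxRegret (M : LinearMDP E n H Rmax) {T : ℕ} (w : Fin T → Round E n H) : ℝ :=
  max (n * M.regWelfare w) (max (M.regAgents w) (M.regSeller w))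

lemma measurable_maxRegret (M : LinearMDP E n H Rmax) (T : ℕ) :
    Measurable fun w : Fin T → Round E n H => maxRegret M w := by
  have hV (ρ : Fin H → E.S → E.A → ℝ) : Measurable fun π => M.value π ρ := measurable_of_countable _
  unfold maxRegret LinearMDP.regWelfare LinearMDP.regAgents LinearMDP.regAgent LinearMDP.regSeller
  have h (ρ : Fin H → E.S → E.A → ℝ) (t : Fin T) :
      Measurable fun w : Fin T → Round E n H => M.value (w t).1 ρ :=
    (hV ρ).comp (by fun_prop)
  fun_prop

end Strategy

/-- The distribution on three states that gives mass `q` to state `1` and the rest to state `2`. -/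
def bern (q : ℝ) : Fin 3 → ℝ := ![0, q, 1 - q]

lemma bern_mem {q : ℝ} (h0 : 0 ≤ q) (h1 : q ≤ 1) : bern q ∈ stdSimplex ℝ (Fin 3) := by
  refine ⟨fun y => ?_, ?_⟩
  · fin_cases y <;> simp [bern, h0, h1]
  · simp [bern, Fin.sum_univ_three]

lemma sum_sq_bern_sub (p q : ℝ) : (∑ y, (bern p y - bern q y) ^ 2) / 2 = (p - q) ^ 2 := by
  simp [bern, Fin.sum_univ_three]
  ring

lemma bern_eq_or_le {p q : ℝ} (hp : 1 / 4 ≤ p ∧ p ≤ 3 / 4) (hq : 1 / 4 ≤ q ∧ q ≤ 3 / 4)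
    (y : Fin 3) : bern p y = bern q y ∨ 1 / 4 ≤ bern p y ∧ 1 / 4 ≤ bern q y := by
  fin_cases y
  · left; simp [bern]
  · right; simp only [bern]; exact ⟨hp.1, hq.1⟩
  · right
    change 1 / 4 ≤ 1 - p ∧ 1 / 4 ≤ 1 - q
    constructor <;> linarith [hp.2, hq.2]

/-! ### The cost of learning transitions: a hidden vertex of a cube. -/

namespace Cube

/-- The actions are the vertices of a cube. -/
abbrev vertex (m : ℕ) : Fin (Fintype.card (Fin m → Bool)) ≃ (Fin m → Bool) :=
  (Fintype.equivFin _).symm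

/-- The weights with which a vertex mixes the features. -/
def weight (m : ℕ) (a : Fin (Fintype.card (Fin m → Bool))) : Fin (3 + m) → ℝ :=
  Fin.addCases (motive := fun _ => ℝ)
    (Pi.single 0 (1 - ∑ j, if vertex m a j then (m : ℝ)⁻¹ else 0))
    fun j => if vertex m a j then (m : ℝ)⁻¹ else 0

lemma weight_mem (m : ℕ) (a : Fin (Fintype.card (Fin m → Bool))) :
    weight m a ∈ stdSimplex ℝ (Fin (3 + m)) := by
  have hle : ∑ j, (if vertex m a j then (m : ℝ)⁻¹ else 0) ≤ 1 := by
    calc _ ≤ ∑ _j : Fin m, (m : ℝ)⁻¹ := Finset.sum_le_sum fun j _ => by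
          split_ifs
          · exact le_rfl
          · positivity
      _ ≤ 1 := by simpa using mul_inv_le_one
  refine ⟨fun j => ?_, ?_⟩
  · refine Fin.addCases (fun i => ?_) (fun j => ?_) j
    · simp only [weight, Fin.addCases_left, Pi.single_apply]
      split_ifs
      · linarith
      · exact le_rfl
    · simp only [weight, Fin.addCases_right]
      positivity
  · rw [Fin.sum_univ_add]
    simp [weight]

lemma card_pos (m : ℕ) : 0 < Fintype.card (Fin m → Bool) := Fintype.card_pos

/-- The sign of a coordinate. -/
def sgn (b : Bool) : ℝ := if b then 1 else -1

/-- The advantage of the vertex `a` when the hidden vertex is `s`. -/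
def adv {m : ℕ} (Δ : ℝ) (s a : Fin m → Bool) : ℝ := Δ * ∑ j, if a j then sgn (s j) else 0

/-- The problem with hidden vertex `s`. -/
def data {m : ℕ} (n : ℕ) {Δ : ℝ} (h0 : 0 ≤ Δ) (hΔ : m * Δ ≤ 1 / 4) (s : Fin m → Bool) :
    ArmData m n where
  ν := Fin.addCases (motive := fun _ => Fin 3 → ℝ) (fun _ => bern (1 / 2))
    fun j => bern (1 / 2 + m * Δ * sgn (s j))
  u _ := ![0, 1, 0]
  ν_mem j := by
    refine Fin.addCases (fun i => ?_) (fun j => ?_) j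
    · simpa using bern_mem (by norm_num) (by norm_num)
    · have : 0 ≤ m * Δ := by positivity
      simp only [Fin.addCases_right, sgn]
      split_ifs <;> exact bern_mem (by linarith) (by linarith)
  u_mem i y := by fin_cases y <;> simp

variable {m n : ℕ} {Δ : ℝ} (h0 : 0 ≤ Δ) (hΔ : m * Δ ≤ 1 / 4) (s : Fin m → Bool)

/-- The weight `1 / m` of a selected coordinate cancels the factor `m` in its bias `m * Δ`, so each
one shifts the success probability by `±Δ`. -/
lemma Q_data (a : Fin (Fintype.card (Fin m → Bool))) :
    (data n h0 hΔ s).Q (weight m) a = bern (1 / 2 + adv Δ s (vertex m a)) := by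
  have h1 : (data n h0 hΔ s).Q (weight m) a 1 = 1 / 2 + adv Δ s (vertex m a) := by
    have e (j : Fin m) : (if vertex m a j then (m : ℝ)⁻¹ else 0) * (1 / 2 + m * Δ * sgn (s j)) =
        (if vertex m a j then (m : ℝ)⁻¹ else 0) * (1 / 2) +
          Δ * if vertex m a j then sgn (s j) else 0 := by
      have : (m : ℝ) ≠ 0 := Nat.cast_ne_zero.2 j.pos.ne'
      split_ifs
      · field_simp
      · simp
    rw [ArmData.Q, Fin.sum_univ_add]
    simp only [data, weight, Fin.addCases_left, Fin.addCases_right, bern, Matrix.cons_val_one,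
      Matrix.cons_val_zero]
    rw [Finset.sum_congr rfl fun j _ => e j, Finset.sum_add_distrib, ← Finset.sum_mul,
      ← Finset.sum_mul, ← Finset.mul_sum, Finset.sum_pi_single']
    simp only [Finset.mem_univ, if_true, adv]
    ring
  have h2 : (data n h0 hΔ s).Q (weight m) a 0 = 0 := by
    rw [ArmData.Q, Fin.sum_univ_add]
    simp [data, bern]
  have h3 := (data n h0 hΔ s).sum_Q (weight_mem m) a
  rw [Fin.sum_univ_three, h1, h2] at h3
  funext y
  fin_cases y
  · exact h2
  · exact h1
  · simp [bern]; linarith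

lemma abs_adv_le (h0 : 0 ≤ Δ) (hΔ : m * Δ ≤ 1 / 4) (s a : Fin m → Bool) : |adv Δ s a| ≤ 1 / 4 := by
  rw [adv, abs_mul, abs_of_nonneg h0]
  have h : |∑ j, if a j then sgn (s j) else 0| ≤ m := by
    refine (Finset.abs_sum_le_sum_abs _ _).trans ?_
    calc _ ≤ ∑ _j : Fin m, (1 : ℝ) := Finset.sum_le_sum fun j _ => by
          unfold sgn; split_ifs <;> simp
      _ = m := by simp
  calc _ ≤ Δ * m := by gcongr
    _ ≤ _ := by linarith

lemma adv_self_sub (s a : Fin m → Bool) :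
    adv Δ s s - adv Δ s a = Δ * ∑ j, if a j = s j then 0 else 1 := by
  rw [adv, adv, ← mul_sub, ← Finset.sum_sub_distrib]
  congr 1
  refine Finset.sum_congr rfl fun j _ => ?_
  cases a j <;> cases s j <;> simp [sgn]

/-- The vertex with coordinate `j` flipped. -/
def flip (j : Fin m) (s : Fin m → Bool) : Fin m → Bool := Function.update s j (!s j)

lemma flip_flip (j : Fin m) : Function.Involutive (flip j) := fun s => by simp [flip]

lemma adv_sub_flip (j : Fin m) (s a : Fin m → Bool) :
    adv Δ s a - adv Δ (flip j s) a = Δ * if a j then 2 * sgn (s j) else 0 := by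
  rw [adv, adv, ← mul_sub, ← Finset.sum_sub_distrib]
  congr 1
  rw [Finset.sum_eq_single j]
  · unfold flip
    cases a j <;> cases s j <;> norm_num [sgn]
  · intro i _ hi
    simp [flip, hi]
  · simp

lemma dist_flip_le (j : Fin m) (a : Fin (Fintype.card (Fin m → Bool))) :
    ArmData.dist (data n h0 hΔ s) (data n h0 hΔ (flip j s)) (weight m) a ≤ 4 * Δ ^ 2 := by
  rw [ArmData.dist, Q_data, Q_data, sum_sq_bern_sub, add_sub_add_left_eq_sub, adv_sub_flip, mul_pow,
    mul_comm]
  gcongr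
  unfold sgn
  split_ifs <;> norm_num

variable {K : ℕ} {Rmax : ℝ} (hR : 0 ≤ Rmax)

/-- The setting of the cube problems. -/
abbrev setting (m : ℕ) : Setting (3 + m) := armSetting m (card_pos m) (weight m) (weight_mem m)

/-- The cube problem with hidden vertex `s`. -/
abbrev problem (K : ℕ) : LinearMDP (setting m) n (K + 1) Rmax :=
  (data n h0 hΔ s).mdp (card_pos m) (weight_mem m) K hR

/-- The number of rounds in which coordinate `j` of the first action is not the one of `s`. -/
def errors {T : ℕ} (s : Fin m → Bool) (j : Fin m) (w : Fin T → Round (setting m) n (K + 1)) : ℕ :=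
  ∑ t, if vertex m ((w t).1 0 (0 : Fin 4)) j = s j then 0 else 1

lemma measurable_errors {T : ℕ} (s : Fin m → Bool) (j : Fin m) :
    Measurable fun w : Fin T → Round (setting m) n (K + 1) => (errors s j w : ℝ≥0∞) := by
  have h : Measurable fun π : Policy (setting m) (K + 1) =>
      if vertex m (π 0 (0 : Fin 4)) j = s j then 0 else 1 := measurable_of_countable _
  refine (measurable_of_countable fun k : ℕ => (k : ℝ≥0∞)).comp ?_
  exact Finset.measurable_sum _ fun t _ => h.comp (by fun_prop)

lemma errors_add_errors_flip {T : ℕ} (s : Fin m → Bool) (j : Fin m)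
    (w : Fin T → Round (setting m) n (K + 1)) : errors s j w + errors (flip j s) j w = T := by
  rw [errors, errors, ← Finset.sum_add_distrib]
  calc _ = ∑ _t : Fin T, 1 := Finset.sum_congr rfl fun t _ => by
        generalize vertex m ((w t).1 0 (0 : Fin 4)) j = b
        simp only [flip, Function.update_self]
        cases b <;> cases s j <;> simp
    _ = T := by simp

lemma le_regWelfare {T : ℕ} (w : Fin T → Round (setting m) n (K + 1)) :
    K * n * Δ * ∑ j, (errors s j w : ℝ) ≤ (problem h0 hΔ s hR K).regWelfare w := by
  have hval (π : Policy (setting m) (K + 1)) :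
      (problem (n := n) h0 hΔ s hR K).value π (problem (n := n) h0 hΔ s hR K).R =
        K * n * (1 / 2 + adv Δ s (vertex m (π 0 (0 : Fin 4)))) := by
    rw [ArmData.value_welfare]
    simp_rw [ArmData.avg, Q_data]
    simp [data, bern, Fin.sum_univ_three]
    ring
  have hopt := (problem (n := n) h0 hΔ s hR K).value_le_optPolicy
    (fun _ _ => (vertex m).symm s) (problem (n := n) h0 hΔ s hR K).R
  rw [hval, Equiv.apply_symm_apply] at hopt
  rw [LinearMDP.regWelfare_eq_sum]
  calc _ = ∑ t, (K * n * Δ * ∑ j, if vertex m ((w t).1 0 (0 : Fin 4)) j = s j then 0 else 1) := by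
        simp only [errors, Nat.cast_sum, Nat.cast_ite, Nat.cast_zero, Nat.cast_one]
        rw [Finset.sum_comm, Finset.mul_sum]
    _ ≤ _ := Finset.sum_le_sum fun t _ => by
        rw [hval (w t).1, mul_assoc, ← adv_self_sub]
        linarith

/-- In every round, coordinate `j` is wrong for exactly one of `s` and `flip j s`, and these two
problems are hard to tell apart. The distance is at most `4 * Δ ^ 2` per round under each law, hence
the `8` in `hT`. -/
lemma le_expectedErrors (σ : Strategy (setting m) n (K + 1)) {T : ℕ} (hT : 8 * T * Δ ^ 2 ≤ 1)
    (j : Fin m) :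
    (T : ℝ≥0∞) / 8 ≤ ∫⁻ w, errors s j w ∂(σ.law (problem h0 hΔ s hR K) T) +
      ∫⁻ w, errors (flip j s) j w ∂(σ.law (problem h0 hΔ (flip j s) hR K) T) := by
  refine ArmData.two_point (D := data n h0 hΔ s) (D' := data n h0 hΔ (flip j s)) rfl
    (fun a y => ?_) σ T ?_ (measurable_errors s j) (measurable_errors _ j) fun w => ?_
  · have hb (s : Fin m → Bool) := abs_le.1 (abs_adv_le h0 hΔ s (vertex m a))
    rw [Q_data, Q_data]
    exact bern_eq_or_le ⟨by linarith [hb s], by linarith [hb s]⟩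
      ⟨by linarith [hb (flip j s)], by linarith [hb (flip j s)]⟩ y
  · have h (M : LinearMDP (setting m) n (K + 1) Rmax) [IsMarkovKernel M.episodeKernel] :
        ∫⁻ w, ∑ t, ENNReal.ofReal (ArmData.dist (data n h0 hΔ s) (data n h0 hΔ (flip j s)) (weight m)
          ((w t).1 0 (0 : Fin 4))) ∂(σ.law M T) ≤ ENNReal.ofReal (T * (4 * Δ ^ 2)) := by
      calc _ ≤ ∫⁻ w, ENNReal.ofReal (T * (4 * Δ ^ 2)) ∂(σ.law M T) := by
            refine lintegral_mono fun w => ?_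
            calc _ ≤ ∑ _t : Fin T, ENNReal.ofReal (4 * Δ ^ 2) := Finset.sum_le_sum fun t _ =>
                  ENNReal.ofReal_le_ofReal (dist_flip_le h0 hΔ s j _)
              _ = _ := by simp [ENNReal.ofReal_mul]
        _ = _ := by simp
    refine (add_le_add (h _) (h _)).trans ?_
    rw [← ENNReal.ofReal_add (by positivity) (by positivity), ← ENNReal.ofReal_one]
    exact ENNReal.ofReal_le_ofReal (by linarith)
  · exact_mod_cast (errors_add_errors_flip s j w).ge

/-- The lower bound for problems whose features are the vertices of a cube. -/
theorem exists_le_expectedMaxRegret (σ : Strategy (setting m) n (K + 1)) {T : ℕ}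
    (hT : 8 * T * Δ ^ 2 ≤ 1) :
    ∃ s : Fin m → Bool, ENNReal.ofReal (n * (K * n * Δ) * (m * T / 16)) ≤
      σ.expectedMaxRegret (problem h0 hΔ s hR K) T := by
  set e : (Fin m → Bool) → Fin m → ℝ≥0∞ := fun s j =>
    ∫⁻ w, errors s j w ∂(σ.law (problem h0 hΔ s hR K) T) with he
  -- Assouad: summing over all `s` counts every vertex twice, as itself and as a flip. This turns `T
  -- / 8` into an average of at least `T / 16` errors per coordinate.
  have hpair (j : Fin m) : ∑ _s : Fin m → Bool, (T : ℝ≥0∞) / 8 ≤ 2 * ∑ s, e s j := by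
    have h1 : ∑ s, e (flip j s) j = ∑ s, e s j :=
      Equiv.sum_comp (flip_flip j).toPerm fun s => e s j
    calc _ ≤ ∑ s, (e s j + e (flip j s) j) :=
          Finset.sum_le_sum fun s _ => le_expectedErrors h0 hΔ s hR σ hT j
      _ = _ := by rw [Finset.sum_add_distrib, h1, two_mul]
  obtain ⟨s, hs⟩ : ∃ s, ENNReal.ofReal (m * T / 16) ≤ ∑ j, e s j := by
    by_contra! hlt
    have h2 := ENNReal.sum_lt_sum_of_nonempty (s := Finset.univ) Finset.univ_nonempty
      fun s _ => hlt s
    rw [Finset.sum_comm] at h2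
    have h3 : ∑ j : Fin m, ∑ _s : Fin m → Bool, (T : ℝ≥0∞) / 8 ≤ 2 * ∑ j, ∑ s, e s j := by
      rw [Finset.mul_sum]
      exact Finset.sum_le_sum fun j _ => hpair j
    refine h2.not_ge ((ENNReal.mul_le_mul_iff_right two_ne_zero ENNReal.ofNat_ne_top).1
      (le_trans (le_of_eq ?_) h3))
    have h8 : 2 * ENNReal.ofReal (m * T / 16) = m * (T / 8) := by
      rw [← ENNReal.ofReal_ofNat, ← ENNReal.ofReal_mul (by norm_num), ← ENNReal.ofReal_natCast m,
        ← ENNReal.ofReal_natCast T, ← ENNReal.ofReal_ofNat, ← ENNReal.ofReal_div_of_pos (by norm_num),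
        ← ENNReal.ofReal_mul (by positivity)]
      congr 1
      ring
    simp only [Finset.sum_const, nsmul_eq_mul, Finset.card_univ, Fintype.card_fin]
    rw [mul_left_comm, h8, mul_left_comm]
  refine ⟨s, ?_⟩
  have hC : 0 ≤ n * (K * n * Δ) := by positivity
  calc _ = ENNReal.ofReal (n * (K * n * Δ)) * ENNReal.ofReal (m * T / 16) :=
        ENNReal.ofReal_mul hC
    _ ≤ ENNReal.ofReal (n * (K * n * Δ)) * ∑ j, e s j := by gcongr
    _ = ∫⁻ w, ENNReal.ofReal (n * (K * n * Δ)) * ∑ j, (errors s j w : ℝ≥0∞)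
          ∂(σ.law (problem h0 hΔ s hR K) T) := by
        rw [lintegral_const_mul _ (Finset.measurable_sum _ fun j _ => measurable_errors s j),
          lintegral_finsetSum _ fun j _ => measurable_errors s j]
    _ ≤ _ := by
        refine lintegral_mono fun w => ?_
        have h4 : ENNReal.ofReal (n * (K * n * Δ)) * ∑ j, (errors s j w : ℝ≥0∞) =
            ENNReal.ofReal (n * (K * n * Δ * ∑ j, (errors s j w : ℝ))) := by
          rw [← mul_assoc (n : ℝ) (K * n * Δ), ENNReal.ofReal_mul hC]
          congr 1
          exact_mod_cast (ENNReal.ofReal_natCast (∑ j, errors s j w)).symm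
        rw [h4]
        refine ENNReal.ofReal_le_ofReal (le_max_of_le_left ?_)
        gcongr
        exact le_regWelfare h0 hΔ s hR w

end Cube

/-! ### The cost of learning prices: two arms. -/

namespace TwoArm

/-- Action `0` uses feature `0`, action `1` the feature `3`. -/
def weight (m : ℕ) (a : Fin 2) : Fin (3 + (m + 1)) → ℝ :=
  ![Pi.single (Fin.castAdd (m + 1) 0) 1, Pi.single (Fin.natAdd 3 0) 1] a

lemma weight_mem (m : ℕ) (a : Fin 2) : weight m a ∈ stdSimplex ℝ (Fin (3 + (m + 1))) := by
  fin_cases a <;> exact single_mem_stdSimplex ℝ _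

/-- Action `0` leads to state `1`, where the agents of `A` get `1/2`; action `1` leads with
probability `q` to state `2`, where the agents of `B` get `1`, and otherwise to state `3`. -/
def data {n : ℕ} (m : ℕ) (A B : Finset (Fin n)) {q : ℝ} (hq : 1 / 4 ≤ q ∧ q ≤ 3 / 4) :
    ArmData (m + 1) n where
  ν := Fin.addCases (motive := fun _ => Fin 3 → ℝ) (fun _ => Pi.single 0 1) fun _ => bern q
  u i := ![if i ∈ A then 1 / 2 else 0, if i ∈ B then 1 else 0, 0]
  ν_mem j := by
    refine Fin.addCases (fun i => ?_) (fun j => ?_) j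
    · simpa using single_mem_stdSimplex ℝ (0 : Fin 3)
    · simpa using bern_mem (by linarith [hq.1]) (by linarith [hq.2])
  u_mem i y := by
    fin_cases y
    · change (if i ∈ A then 1 / 2 else 0 : ℝ) ∈ _
      split_ifs <;> norm_num
    · change (if i ∈ B then 1 else 0 : ℝ) ∈ _
      split_ifs <;> norm_num
    · simp

variable {n m : ℕ} (A B : Finset (Fin n)) {q : ℝ} (hq : 1 / 4 ≤ q ∧ q ≤ 3 / 4)

lemma Q_zero : (data m A B hq).Q (weight m) 0 = Pi.single 0 1 := by
  funext y
  simp [ArmData.Q, weight, Pi.single_apply, data]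

lemma Q_one : (data m A B hq).Q (weight m) 1 = bern q := by
  funext y
  simp [ArmData.Q, weight, Pi.single_apply, data]

/-- Only the inferior action is informative. -/
lemma dist_eq {p : ℝ} (hp : 1 / 4 ≤ p ∧ p ≤ 3 / 4) (a : Fin 2) :
    ArmData.dist (data m A B hq) (data m A B hp) (weight m) a = if a = 1 then (q - p) ^ 2 else 0 := by
  unfold ArmData.dist
  fin_cases a
  · simp [Q_zero]
  · simpa [Q_one] using sum_sq_bern_sub q p

lemma avg_eq (i : Fin n) (a : Fin 2) : (data m A B hq).avg (weight m) ((data m A B hq).u i) a =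
    if a = 0 then (if i ∈ A then 1 / 2 else 0) else if i ∈ B then q else 0 := by
  fin_cases a
  · simp only [ArmData.avg, Fin.zero_eta, Q_zero]
    simp [data, Fin.sum_univ_three]
  · simp only [ArmData.avg, Fin.mk_one, Q_one]
    simp [data, Fin.sum_univ_three, bern]

lemma sum_avg_eq (a : Fin 2) : ∑ i, (data m A B hq).avg (weight m) ((data m A B hq).u i) a =
    if a = 0 then (A.card : ℝ) / 2 else B.card * q := by
  simp_rw [avg_eq]
  split_ifs
  · simp [div_eq_mul_inv]
  · simp

variable {K : ℕ} {Rmax : ℝ} (hR : 0 ≤ Rmax)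

/-- The setting of the two-armed problems. -/
abbrev setting (m : ℕ) : Setting (3 + (m + 1)) :=
  armSetting (m + 1) two_pos (weight m) (weight_mem m)

/-- The two-armed problem in which action `1` leads to state `2` with probability `q`. -/
abbrev problem (m K : ℕ) : LinearMDP (setting m) n (K + 1) Rmax :=
  (data m A B hq).mdp two_pos (weight_mem m) K hR

variable {A B} {k : ℕ} {δ : ℝ}

lemma value_R_eq (hA : A.card = k) (hB : B.card = k) (hδ : k * q = k / 2 - δ)
    (π : Policy (setting m) (K + 1)) :
    (problem A B hq hR m K).value π (problem A B hq hR m K).R =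
      K * if π 0 (0 : Fin 4) = (0 : Fin 2) then (k : ℝ) / 2 else k / 2 - δ := by
  rw [ArmData.value_welfare, sum_avg_eq, hA, hB, hδ]

lemma value_optPolicy_R (hA : A.card = k) (hB : B.card = k) (hδ : k * q = k / 2 - δ)
    (h0 : 0 ≤ δ) :
    (problem A B hq hR m K).value ((problem A B hq hR m K).optPolicy (problem A B hq hR m K).R)
      (problem A B hq hR m K).R = K * (k / 2) := by
  refine le_antisymm ?_ ?_
  · rw [value_R_eq hq hR hA hB hδ]
    gcongr
    split_ifs <;> linarith
  · refine le_trans (le_of_eq ?_) ((problem A B hq hR m K).value_le_optPolicy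
      (fun _ _ => (0 : Fin 2)) _)
    rw [value_R_eq hq hR hA hB hδ, if_pos rfl]

lemma optPolicy_R (hA : A.card = k) (hB : B.card = k) (hδ : k * q = k / 2 - δ)
    (h0 : 0 < δ) (hK : 0 < K) :
    (problem A B hq hR m K).optPolicy (problem A B hq hR m K).R 0 (0 : Fin 4) = (0 : Fin 2) := by
  by_contra h
  have h1 := value_optPolicy_R hq hR (m := m) (K := K) hA hB hδ h0.le
  rw [value_R_eq hq hR hA hB hδ, if_neg h] at h1
  have hK' : (0 : ℝ) < K := Nat.cast_pos.2 hK
  have := mul_left_cancel₀ hK'.ne' h1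
  linarith

/-- Without an agent of `A`, action `0` drops to `k / 2 - 1 / 2` per step and action `1`, at `k / 2
- δ`, takes over because `δ ≤ 1 / 2`; the others then lose `1 / 2 - δ` by that agent's presence. An
agent outside `A` is not pivotal. -/
lemma vcgPrice_eq (hAB : Disjoint A B) (hA : A.card = k) (hB : B.card = k)
    (hδ : k * q = k / 2 - δ) (h0 : 0 < δ) (h1 : δ ≤ 1 / 2) (hK : 0 < K) (i : Fin n) :
    (problem A B hq hR m K).vcgPrice i = if i ∈ A then K * (1 / 2 - δ) else 0 := by
  have hval (π : Policy (setting m) (K + 1)) :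
      (problem A B hq hR m K).value π ((problem A B hq hR m K).Rwithout i) =
        K * if π 0 (0 : Fin 4) = (0 : Fin 2) then (k : ℝ) / 2 - (if i ∈ A then 1 / 2 else 0)
          else k / 2 - δ - if i ∈ B then q else 0 := by
    rw [LinearMDP.value_Rwithout, value_R_eq hq hR hA hB hδ, ArmData.value_agent, avg_eq, ← mul_sub]
    congr 1
    split_ifs <;> rfl
  have hiB : i ∈ A → i ∉ B := fun h h' => Finset.disjoint_left.1 hAB h h'
  rw [LinearMDP.vcgPrice, hval ((problem A B hq hR m K).optPolicy (problem A B hq hR m K).R),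
    optPolicy_R hq hR hA hB hδ h0 hK, if_pos rfl]
  have hK' : (0 : ℝ) ≤ K := Nat.cast_nonneg K
  refine le_antisymm ?_ ?_
  · rw [hval, ← mul_sub]
    by_cases hi : i ∈ A
    · simp only [hi, hiB hi, if_true, if_false]
      refine mul_le_mul_of_nonneg_left ?_ hK'
      split_ifs <;> linarith
    · simp only [hi, if_false]
      refine mul_nonpos_of_nonneg_of_nonpos hK' ?_
      split_ifs <;> linarith [hq.1]
  · by_cases hi : i ∈ A
    · have h2 := (problem A B hq hR m K).value_le_optPolicy (fun _ _ => (1 : Fin 2))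
        ((problem A B hq hR m K).Rwithout i)
      rw [hval (fun _ _ => (1 : Fin 2)), if_neg one_ne_zero] at h2
      simp only [hi, hiB hi, if_true, if_false] at h2 ⊢
      linarith
    · have h2 := (problem A B hq hR m K).value_le_optPolicy (fun _ _ => (0 : Fin 2))
        ((problem A B hq hR m K).Rwithout i)
      rw [hval (fun _ _ => (0 : Fin 2)), if_pos rfl] at h2
      simp only [hi, if_false] at h2 ⊢
      linarith

lemma regSeller_eq (hAB : Disjoint A B) (hA : A.card = k) (hB : B.card = k)
    (hδ : k * q = k / 2 - δ) (h0 : 0 < δ) (h1 : δ ≤ 1 / 2) (hK : 0 < K) {T : ℕ}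
    (w : Fin T → Round (setting m) n (K + 1)) :
    (problem A B hq hR m K).regSeller w =
      T * (K * k * (1 / 2 - δ)) - ∑ t, ∑ i, (w t).2.2 i := by
  unfold LinearMDP.regSeller LinearMDP.vcgSellerUtility
  have h2 : ∑ i, (if i ∈ A then K * (1 / 2 - δ) else 0) = K * k * (1 / 2 - δ) := by
    simp [hA]
    ring
  simp_rw [vcgPrice_eq hq hR hAB hA hB hδ h0 h1 hK, ArmData.value_seller, zero_add, h2]

/-- The number of rounds in which the first action is `1`. -/
def explorations {T : ℕ} (w : Fin T → Round (setting m) n (K + 1)) : ℕ :=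
  ∑ t, if (w t).1 0 (0 : Fin 4) = (1 : Fin 2) then 1 else 0

lemma measurable_explorations (T : ℕ) :
    Measurable fun w : Fin T → Round (setting m) n (K + 1) => (explorations w : ℝ≥0∞) := by
  have h : Measurable fun π : Policy (setting m) (K + 1) =>
      if π 0 (0 : Fin 4) = (1 : Fin 2) then 1 else 0 := measurable_of_countable _
  refine (measurable_of_countable fun k : ℕ => (k : ℝ≥0∞)).comp ?_
  exact Finset.measurable_sum _ fun t _ => h.comp (by fun_prop)

lemma regWelfare_eq (hA : A.card = k) (hB : B.card = k) (hδ : k * q = k / 2 - δ)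
    (h0 : 0 ≤ δ) {T : ℕ} (w : Fin T → Round (setting m) n (K + 1)) :
    (problem A B hq hR m K).regWelfare w = K * δ * explorations w := by
  rw [LinearMDP.regWelfare_eq_sum, value_optPolicy_R hq hR hA hB hδ h0]
  simp only [explorations, Nat.cast_sum, Finset.mul_sum]
  refine Finset.sum_congr rfl fun t _ => ?_
  rw [value_R_eq hq hR hA hB hδ]
  generalize (w t).1 0 (0 : Fin 4) = a
  revert a
  change ∀ a : Fin 2, _
  intro a
  fin_cases a
  · simp
  · simp
    ring

/-- Either of two problems with different prices has a large regret: to tell them apart takes many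
explorations, and these are costly. -/
theorem le_add_expectedMaxRegret (hAB : Disjoint A B) (hA : A.card = k) (hB : B.card = k)
    (hK : 0 < K) {p δ' : ℝ} (hp : 1 / 4 ≤ p ∧ p ≤ 3 / 4)
    (hδ : k * q = k / 2 - δ) (hδ' : k * p = k / 2 - δ') (h0 : 0 < δ) (h1 : δ ≤ δ') (h2 : δ' ≤ 1 / 2)
    (σ : Strategy (setting m) n (K + 1)) {T : ℕ} {X : ℝ} (hX : 0 ≤ X)
    (hX1 : 8 * X ≤ T * (K * k * (δ' - δ))) (hX2 : X * (q - p) ^ 2 ≤ n * (K * δ)) :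
    ENNReal.ofReal X ≤ σ.expectedMaxRegret (problem A B hq hR m K) T +
      σ.expectedMaxRegret (problem A B hp hR m K) T := by
  have hdist (M : LinearMDP (setting m) n (K + 1) Rmax) :
      ∫⁻ w, ∑ t, ENNReal.ofReal (ArmData.dist (data m A B hq) (data m A B hp) (weight m)
        ((w t).1 0 (0 : Fin 4))) ∂(σ.law M T) =
      ENNReal.ofReal ((q - p) ^ 2) * ∫⁻ w, explorations w ∂(σ.law M T) := by
    rw [← lintegral_const_mul _ (measurable_explorations T)]
    refine lintegral_congr fun w => ?_
    simp_rw [dist_eq, explorations, Nat.cast_sum, Finset.mul_sum]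
    refine Finset.sum_congr rfl fun t _ => ?_
    split_ifs <;> simp
  -- Few explorations under both laws leave the problems indistinguishable; otherwise the welfare
  -- regrets alone suffice.
  by_cases hle : ENNReal.ofReal ((q - p) ^ 2) *
      ∫⁻ w, explorations w ∂(σ.law (problem A B hq hR m K) T) + ENNReal.ofReal ((q - p) ^ 2) *
      ∫⁻ w, explorations w ∂(σ.law (problem A B hp hR m K) T) ≤ 1
  · rw [← hdist, ← hdist] at hle
    have h := ArmData.two_point (D := data m A B hq) (D' := data m A B hp) rfl (fun a y => ?_) σ T
      hle (F := fun w => ENNReal.ofReal (Strategy.maxRegret (problem A B hq hR m K) w))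
      (F' := fun w => ENNReal.ofReal (Strategy.maxRegret (problem A B hp hR m K) w))
      (Strategy.measurable_maxRegret _ _).ennreal_ofReal
      (Strategy.measurable_maxRegret _ _).ennreal_ofReal
      (C := ENNReal.ofReal (T * (K * k * (δ' - δ)))) fun w => ?_
    · refine le_trans ?_ h
      rw [← ENNReal.ofReal_ofNat, ← ENNReal.ofReal_div_of_pos (by norm_num)]
      exact ENNReal.ofReal_le_ofReal (by linarith)
    · fin_cases a
      · left; simp [Q_zero]
      · simp only [Fin.mk_one, Q_one]
        exact bern_eq_or_le hq hp y
    · have h3 : (problem A B hq hR m K).regSeller w ≤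
          Strategy.maxRegret (problem A B hq hR m K) w := (le_max_right _ _).trans (le_max_right _ _)
      have h4 : (problem A B hp hR m K).regAgents w ≤
          Strategy.maxRegret (problem A B hp hR m K) w := (le_max_left _ _).trans (le_max_right _ _)
      -- The same charges count as seller regret for `q` and as agent regret for `p`. They cancel in
      -- the sum, leaving the difference of the VCG revenues.
      have h5 := (problem A B hp hR m K).regAgents_add_regSeller w
      have h6 := (problem A B hp hR m K).regWelfare_nonneg w
      rw [regSeller_eq hq hR hAB hA hB hδ h0 (h1.trans h2) hK] at h3
      rw [regSeller_eq hp hR hAB hA hB hδ' (h0.trans_le h1) h2 hK] at h5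
      refine le_trans (ENNReal.ofReal_le_ofReal ?_) ENNReal.ofReal_add_le
      linarith
  -- In either problem an exploration costs at least `K * δ` of welfare, which the maximum counts
  -- `n` times.
  · have hE {r ε : ℝ} (hr : 1 / 4 ≤ r ∧ r ≤ 3 / 4) (hε : k * r = k / 2 - ε) (hδε : δ ≤ ε) :
        ENNReal.ofReal (n * (K * δ)) * ∫⁻ w, explorations w ∂(σ.law (problem A B hr hR m K) T) ≤
          σ.expectedMaxRegret (problem A B hr hR m K) T := by
      rw [← lintegral_const_mul _ (measurable_explorations T)]
      refine lintegral_mono fun w => ?_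
      rw [← ENNReal.ofReal_natCast, ← ENNReal.ofReal_mul (by positivity)]
      refine ENNReal.ofReal_le_ofReal (le_max_of_le_left ?_)
      rw [regWelfare_eq hr hR hA hB hε (h0.le.trans hδε), mul_assoc]
      gcongr
    refine le_trans ?_ (add_le_add (hE hq hδ le_rfl) (hE hp hδ' h1))
    rw [← mul_add] at hle ⊢
    calc ENNReal.ofReal X ≤ ENNReal.ofReal X * _ := le_mul_of_one_le_right' (not_le.1 hle).le
      _ ≤ _ := by
        rw [← mul_assoc, ← ENNReal.ofReal_mul hX]
        gcongr

end TwoArm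

/-! ### Choice of the parameters and conclusion. -/

lemma exists_two_thirds_power {n H T : ℝ} (hn : 0 < n) (hH : 0 < H) (hT : 0 < T) :
    ∃ b : ℝ, 0 < b ∧ b ^ 3 = n ^ 2 * H * T ∧
      b ^ 2 = n ^ (4 / 3 : ℝ) * H ^ (2 / 3 : ℝ) * T ^ (2 / 3 : ℝ) := by
  refine ⟨(n ^ 2 * H * T) ^ (1 / 3 : ℝ), by positivity, ?_, ?_⟩
  · rw [← Real.rpow_natCast, ← Real.rpow_mul (by positivity)]
    norm_num
  · rw [← Real.rpow_natCast, ← Real.rpow_mul (by positivity), Real.mul_rpow (by positivity) hT.le,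
      Real.mul_rpow (by positivity) hH.le, ← Real.rpow_natCast n, ← Real.rpow_mul hn.le]
    norm_num

/-- The part of the lower bound that comes from learning the prices. -/
theorem TwoArm.exists_le_expectedMaxRegret {n K m T : ℕ} {Rmax : ℝ} (hR : 0 ≤ Rmax) (hn : 3 ≤ n)
    (hK : 0 < K) {b : ℝ} (hb0 : 0 < b) (hb : b ^ 3 = n ^ 2 * (K + 1) * T)
    (hT : 8 * n ≤ ((K : ℝ) + 1) * T) (σ : Strategy (setting m) n (K + 1)) :
    ∃ M : LinearMDP (setting m) n (K + 1) Rmax,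
      ENNReal.ofReal (b ^ 2 / 576) ≤ σ.expectedMaxRegret M T := by
  obtain ⟨k, hk1, hk2⟩ : ∃ k, 2 * k ≤ n ∧ n ≤ 3 * k := ⟨n / 2, by omega, by omega⟩
  obtain ⟨A, -, hA⟩ := Finset.exists_subset_card_eq
    (s := (Finset.univ : Finset (Fin n))) (n := k) (by simp; omega)
  obtain ⟨B, hBA, hB⟩ := Finset.exists_subset_card_eq (s := Aᶜ) (n := k)
    (by rw [Finset.card_compl, hA, Fintype.card_fin]; omega)
  have hAB : Disjoint A B := (Finset.subset_compl_iff_disjoint_left).1 hBA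
  have hn' : (3 : ℝ) ≤ n := by exact_mod_cast hn
  have hK' : (1 : ℝ) ≤ K := by exact_mod_cast hK
  have hk1' : 2 * (k : ℝ) ≤ n := by exact_mod_cast hk1
  have hk2' : (n : ℝ) ≤ 3 * k := by exact_mod_cast hk2
  have hk0 : (1 : ℝ) ≤ k := by linarith
  have hbn : 2 * (n : ℝ) ≤ b := by
    refine le_of_pow_le_pow_left₀ three_ne_zero hb0.le ?_
    rw [hb]
    nlinarith [mul_le_mul_of_nonneg_left hT (sq_nonneg (n : ℝ))]
  -- The gap between the success probabilities. `b ≥ 2 * n` keeps `k * η`, the gap between the two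
  -- values of `δ`, below `1 / 8`.
  set η : ℝ := 1 / (2 * b) with hη
  have hη0 : 0 < η := by positivity
  have hkη : k * η ≤ 1 / 8 := by
    rw [hη, mul_one_div, div_le_iff₀ (by positivity)]
    linarith
  have hq : 1 / 4 ≤ 1 / 2 - 1 / 16 / (k : ℝ) ∧ 1 / 2 - 1 / 16 / (k : ℝ) ≤ 3 / 4 := by
    have h1 : 1 / 16 / (k : ℝ) ≤ 1 / 16 := div_le_self (by norm_num) hk0
    have h2 : 0 ≤ 1 / 16 / (k : ℝ) := by positivity
    constructor <;> linarith
  have hp : 1 / 4 ≤ 1 / 2 - (1 / 16 + k * η) / (k : ℝ) ∧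
      1 / 2 - (1 / 16 + k * η) / (k : ℝ) ≤ 3 / 4 := by
    have h1 : (1 / 16 + k * η) / (k : ℝ) ≤ 1 / 16 + k * η := div_le_self (by positivity) hk0
    have h2 : 0 ≤ (1 / 16 + k * η) / (k : ℝ) := by positivity
    constructor <;> linarith
  -- The price error adds up to `T * K * k ^ 2 * η`; with `n ≤ 3 * k` and `K + 1 ≤ 2 * K` this is at
  -- least `b ^ 3 / (36 * b)`.
  have hX1 : 8 * (b ^ 2 / 288) ≤ T * (K * k * (1 / 16 + k * η - 1 / 16)) := by
    have h1 : (n : ℝ) ^ 2 * (K + 1) * T ≤ (3 * k) ^ 2 * (K + K) * T := by gcongr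
    have h2 : T * (K * k * (1 / 16 + k * η - 1 / 16)) =
        ((3 * k) ^ 2 * (K + K) * T) / (36 * b) := by
      rw [hη]; field_simp; ring
    rw [h2, le_div_iff₀ (by positivity)]
    linarith [hb]
  -- Here there is room to spare: the left side is `1 / 1152`, the right side grows with `n * K`.
  have hX2 : b ^ 2 / 288 * (1 / 2 - 1 / 16 / (k : ℝ) - (1 / 2 - (1 / 16 + k * η) / (k : ℝ))) ^ 2 ≤
      n * (K * (1 / 16)) := by
    have h1 : 1 / 2 - 1 / 16 / (k : ℝ) - (1 / 2 - (1 / 16 + k * η) / (k : ℝ)) = η := by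
      field_simp; ring
    have h2 : b ^ 2 / 288 * η ^ 2 = 1 / 1152 := by
      rw [hη]; field_simp; norm_num
    rw [h1, h2]
    nlinarith
  have key := TwoArm.le_add_expectedMaxRegret hq hR hAB hA hB hK hp (δ := 1 / 16)
    (δ' := 1 / 16 + k * η) (by field_simp) (by field_simp) (by norm_num)
    (by linarith [mul_pos (zero_lt_one.trans_le hk0) hη0])
    (by linarith) σ (T := T) (X := b ^ 2 / 288) (by positivity) hX1 hX2
  have hhalf : ENNReal.ofReal (b ^ 2 / 288) =
      ENNReal.ofReal (b ^ 2 / 576) + ENNReal.ofReal (b ^ 2 / 576) := by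
    rw [← ENNReal.ofReal_add (by positivity) (by positivity)]
    congr 1
    ring
  rw [hhalf] at key
  by_contra! hlt
  exact (ENNReal.add_lt_add (hlt _) (hlt _)).not_ge key

/-- The part of the lower bound that comes from learning the transitions. -/
theorem Cube.exists_problem {n K m T : ℕ} {Rmax : ℝ} (hR : 0 ≤ Rmax) (hK : 0 < K)
    (hT : 64 * ((m : ℝ) + 1) ^ 2 * (K + 1) ≤ T) (σ : Strategy (setting (m + 1)) n (K + 1)) :
    ∃ M : LinearMDP (setting (m + 1)) n (K + 1) Rmax,
      ENNReal.ofReal ((n : ℝ) ^ 2 * (m + 4) * √((K + 1) * T) / 512) ≤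
        σ.expectedMaxRegret M T := by
  have hK' : (1 : ℝ) ≤ K := by exact_mod_cast hK
  have hm : ((m : ℝ) + 1) ^ 2 ≤ T := by nlinarith [sq_nonneg ((m : ℝ) + 1)]
  have hT0 : (0 : ℝ) < T := lt_of_lt_of_le (by positivity) hm
  have hs : (m : ℝ) + 1 ≤ √T := Real.le_sqrt_of_sq_le hm
  have hs0 : 0 < √(T : ℝ) := Real.sqrt_pos.2 hT0
  have hsq : √(T : ℝ) ^ 2 = T := Real.sq_sqrt hT0.le
  -- With `Δ = 1 / (4 * √T)`, `8 * T * Δ ^ 2 = 1 / 2`, and the biases stay within `1 / 4` because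
  -- the cube's dimension is at most `√T`.
  have h0 : 0 ≤ 1 / (4 * √(T : ℝ)) := by positivity
  have hΔ : ((m + 1 : ℕ) : ℝ) * (1 / (4 * √(T : ℝ))) ≤ 1 / 4 := by
    rw [mul_one_div, div_le_iff₀ (by positivity)]
    push_cast
    linarith
  obtain ⟨s, hs'⟩ := Cube.exists_le_expectedMaxRegret (n := n) (K := K) h0 hΔ hR σ (T := T) (by
    rw [div_pow, mul_pow, hsq]
    field_simp
    norm_num)
  refine ⟨_, le_trans (ENNReal.ofReal_le_ofReal ?_) hs'⟩
  have h1 : (n : ℝ) * (K * n * (1 / (4 * √(T : ℝ)))) * (((m + 1 : ℕ) : ℝ) * T / 16) =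
      (n : ℝ) ^ 2 * (4 * (m + 1)) * ((K + K) * √T) / 512 := by
    push_cast
    nth_rw 2 [← hsq]
    field_simp
    ring
  have h2 : √(((K : ℝ) + 1) * T) ≤ (K + K) * √T := by
    rw [Real.sqrt_mul (by positivity)]
    gcongr
    exact Real.sqrt_le_iff.2 ⟨by linarith, by nlinarith⟩
  rw [h1]
  gcongr
  linarith

end LinVCG

end

theorem theorem3 :
    ∃ c : ℝ, 0 < c ∧
      ∀ (n H d T : ℕ) (Rmax : ℝ), 3 ≤ n → 2 ≤ H → 4 ≤ d → 0 ≤ Rmax →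
        max (16 * ((n : ℝ) - 1) / ((H : ℝ) - 1)) (64 * ((d : ℝ) - 3) ^ 2 * (H : ℝ)) ≤ (T : ℝ) →
        ∀ alg : LinVCG.Algorithm n H d,
          ∃ (E : LinVCG.Setting d) (M : LinVCG.LinearMDP E n H Rmax),
            ENNReal.ofReal
                (c * ((n : ℝ) ^ (4 / 3 : ℝ) * (H : ℝ) ^ (2 / 3 : ℝ) * (T : ℝ) ^ (2 / 3 : ℝ)
                  + (n : ℝ) ^ 2 * (d : ℝ) * √((H : ℝ) * (T : ℝ))))
              ≤ (alg E).expectedMaxRegret M T := by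
  -- Taking the larger of the two bounds, with constants `1 / 576` and `1 / 512`, any `c ≤ 1 / (576
  -- + 512)` would do.
  refine ⟨1 / 2000, by norm_num, fun n H d T Rmax hn hH hd hR hT alg => ?_⟩
  obtain ⟨K, rfl⟩ := Nat.exists_eq_add_of_le' (show 1 ≤ H by omega)
  obtain ⟨m, rfl⟩ : ∃ m, d = 3 + (m + 1) := ⟨d - 4, by omega⟩
  have hK : 0 < K := by omega
  have hn' : (3 : ℝ) ≤ n := by exact_mod_cast hn
  have hK' : (1 : ℝ) ≤ K := by exact_mod_cast hK
  push_cast at hT ⊢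
  have hT1 := (le_max_left _ _).trans hT
  have hT2 := (le_max_right _ _).trans hT
  rw [add_sub_cancel_right, div_le_iff₀ (by linarith)] at hT1
  rw [add_sub_cancel_left] at hT2
  have hT0 : (0 : ℝ) < T := lt_of_lt_of_le (by positivity) hT2
  obtain ⟨b, hb0, hb3, hb2⟩ := LinVCG.exists_two_thirds_power (n := n) (H := K + 1) (T := T)
    (by linarith) (by linarith) hT0
  rw [← hb2, show (3 : ℝ) + (m + 1) = m + 4 by ring]
  have hD : 0 ≤ (n : ℝ) ^ 2 * (m + 4) * √((K + 1) * T) := by positivity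
  have hB : 0 ≤ b ^ 2 := by positivity
  rcases le_total (b ^ 2 / 576) ((n : ℝ) ^ 2 * (m + 4) * √((K + 1) * T) / 512) with h | h
  · obtain ⟨M, hM⟩ := LinVCG.Cube.exists_problem (n := n) hR hK hT2 (alg _)
    refine ⟨_, M, le_trans (ENNReal.ofReal_le_ofReal ?_) hM⟩
    linarith
  · obtain ⟨M, hM⟩ := LinVCG.TwoArm.exists_le_expectedMaxRegret (m := m) hR hn hK hb0 hb3
      (by linarith) (alg _)
    refine ⟨_, M, le_trans (ENNReal.ofReal_le_ofReal ?_) hM⟩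
    linarith
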